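/- **Conventions.** Circuits have fan-in at most 2: gates are And, Or (fan-in 2), Not, Copy (fan-in 1), Input $x_i$ with $i<n$, and Constants (fan-in 0). The gates of a circuit are labelled by distinct bit strings of a common length; the circuit is acyclic and has a designated output gate. The *type* of an Input gate includes the index $i$. A family $\{C'_n\}_n$, where $C'_n$ has $n$ input variables, is *log-space uniform* if there is a Turing machine that, on input the label $g$ of a gate of $C'_n$ and $n$ in binary, uses space $O(\log n)$ (the space occupied by its input included, so that labels have $O(\log n)$ bits) and outputs the types and labels of the children of $g$. In $O(\cdot)$ bounds, $\log n$ stands for $\lfloor\log_2 n\rfloor+1$ (for $1$ if $n=0$). **Theorem 3 (L-uniform $\Rightarrow$ local-uniform).** Let $f:\{0,1\}^*\to\{0,1\}$ be computable by a log-space uniform family of polynomial-size circuits. Then $f$ is computable by a family of polynomial-size circuits $C=\{C_n:\{0,1\}^n\to\{0,1\}\}_n$ whose gates are labelled by strings of $\ell=\ell(n)=O(\log n)$ bits, such that there is a Turing machine that on input $n$ (in binary) runs in time polynomial in the length of $n$, i.e. $\mathrm{poly}\log n$, and outputs a description (for each output bit, the input positions that it reads and a truth table) of a map $D=D_n:\{0,1\}^{\ell}\to\{0,1\}^{O(\log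 n)}$ with the following properties: (i) $D$ has constant locality: there is a constant $k$, independent of $n$, such that every output bit of $D$ depends on at most $k$ input bits; (ii) on input the label $g$ of a gate of $C_n$, $D$ outputs the type of $g$ (with the index of the input variable if $g$ is an Input gate) and the label of each child of $g$; (iii) the directed graph on all of $\{0,1\}^{\ell}$ in which each string $g$ is joined to the children that $D(g)$ specifies has no cycle, so that strings that do not label gates of $C_n$ create no cycles either. -/

import Mathlib

/-! Boolean circuits whose gates are labelled by bit strings. -/

/-- The type of a gate together with the labels of its children.  The type of an input gate
includes the index of the input variable that it reads. -/
inductive Gate where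
  | and (a b : List Bool)
  | or (a b : List Bool)
  | not (a : List Bool)
  | copy (a : List Bool)
  | input (i : ℕ)
  | const (b : Bool)

namespace Gate

/-- The labels of the children of a gate, in order. -/
def children : Gate → List (List Bool)
  | and a b => [a, b]
  | or a b => [a, b]
  | not a => [a]
  | copy a => [a]
  | input _ => []
  | const _ => []

/-- The value of a gate on the input `x`, when `v c` is the value of the child labelled `c`. -/
def eval (x : List Bool) (v : List Bool → Bool) : Gate → Bool
  | and a b => v a && v b
  | or a b => v a || v b
  | not a => !(v a)
  | copy a => v a
  | input i => x.getD i false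
  | const b => b

theorem eval_congr {x : List Bool} {v w : List Bool → Bool} (G : Gate)
    (h : ∀ c ∈ G.children, v c = w c) : G.eval x v = G.eval x w := by
  cases G <;> simp_all [eval, children]

/-- The type of a gate, as a word: three bits, followed by the index of the variable in binary
(least significant bit first) in the case of an input gate. -/
def typeWord : Gate → List Bool
  | and _ _ => [false, false, false]
  | or _ _ => [false, false, true]
  | not _ => [false, true, false]
  | copy _ => [false, true, true]
  | input i => [true, false, false] ++ i.bits
  | const b => [true, true, b]

end Gate

/-- A Boolean circuit with `n` input variables.  Its gates are labelled by distinct bit strings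
of a common length `len`; it is identified with its set of labels and the map that sends
a label to the type and the children of the gate. -/
structure Circuit (n : ℕ) where
  /-- length of the labels -/
  len : ℕ
  /-- the labels of the gates -/
  gates : Finset (List Bool)
  length_eq : ∀ g ∈ gates, g.length = len
  /-- type and children of a gate (the value outside `gates` plays no role) -/
  gate : List Bool → Gate
  input_lt : ∀ g ∈ gates, ∀ i, gate g = Gate.input i → i < n
  child_mem : ∀ g ∈ gates, ∀ c ∈ (gate g).children, c ∈ gates
  /-- there are no cycles (the set of gates is finite) -/
  acyclic : WellFounded fun c g => g ∈ gates ∧ c ∈ (gate g).children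
  /-- the output gate -/
  out : List Bool
  out_mem : out ∈ gates

namespace Circuit

/-- The number of gates. -/
def size {n : ℕ} (C : Circuit n) : ℕ := C.gates.card

open Classical in
/-- The value of each gate on the input `x`, by recursion along the wires. -/
noncomputable def val {n : ℕ} (C : Circuit n) (x : List Bool) : List Bool → Bool :=
  C.acyclic.fix fun g ih =>
    (C.gate g).eval x fun c =>
      if h : g ∈ C.gates ∧ c ∈ (C.gate g).children then ih c h else false

/-- The value of a gate is obtained from the values of its children. -/
theorem val_eq {n : ℕ} (C : Circuit n) (x : List Bool) {g : List Bool} (hg : g ∈ C.gates) :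
    C.val x g = (C.gate g).eval x (C.val x) := by
  classical
  rw [val, WellFounded.fix_eq]
  refine Gate.eval_congr _ fun c hc => ?_
  rw [dif_pos ⟨hg, hc⟩]

/-- The value of the circuit, i.e. of its output gate. -/
noncomputable def eval {n : ℕ} (C : Circuit n) (x : List Bool) : Bool := C.val x C.out

end Circuit

/-- The family computes `f : {0,1}* → {0,1}`. -/
def Computes (C : (n : ℕ) → Circuit n) (f : List Bool → Bool) : Prop :=
  ∀ n, ∀ x : List Bool, x.length = n → (C n).eval x = f x

/-- The family has polynomial size. -/
def PolySize (C : (n : ℕ) → Circuit n) : Prop :=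
  ∃ k : ℕ, ∀ n, (C n).size ≤ n ^ k + k

/-! Log-space uniformity.  The machine model is `Turing.FinTM2`: finitely many states and finitely
many stacks (a tape is a pair of stacks).  The third symbol `none` is a separator. -/

/-- The input `(g, n)` of the uniformity machine, `n` in binary. -/
def queryWord (g : List Bool) (n : ℕ) : List (Option Bool) :=
  g.map some ++ none :: n.bits.map some

/-- The list of the types and labels of the children of the gate `g`. -/
def childrenWord {n : ℕ} (C : Circuit n) (g : List Bool) : List (Option Bool) :=
  (C.gate g).children.flatMap fun c =>
    (C.gate c).typeWord.map some ++ none :: (c.map some ++ [none])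

/-- The machine, started on the word `w`, never has more than `s` symbols on a stack.
The input stack counts. -/
def UsesSpace (tm : Turing.FinTM2) (w : List (tm.Γ tm.k₀)) (s : ℕ) : Prop :=
  ∀ cfg : Turing.TM2.Cfg tm.Γ tm.Λ tm.σ,
    Turing.TM2.Reaches tm.m (Turing.initList tm w) cfg → ∀ k, (cfg.stk k).length ≤ s

/-- The family is log-space uniform: some machine, given the label `g` of a gate of the `n`-th
circuit and `n` in binary, halts with the types and labels of the children of `g` as its output,
using space `O(log n)`.  (In particular the labels have length `O(log n)`, since
the machine's input is a part of the space used.) -/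
def LogSpaceUniform (C : (n : ℕ) → Circuit n) : Prop :=
  ∃ (M : Turing.TM2ComputableAux (Option Bool) (Option Bool)) (c : ℕ),
    ∀ n, ∀ g ∈ (C n).gates,
      Nonempty (Turing.TM2Outputs M.tm ((queryWord g n).map M.inputAlphabet.symm)
        (some ((childrenWord (C n) g).map M.outputAlphabet.symm))) ∧
      UsesSpace M.tm ((queryWord g n).map M.inputAlphabet.symm) (c * (Nat.log 2 n + 1))

/-! Maps on bit strings, each of whose output bits is given by a list of input positions
and a truth table. -/

/-- The number with the given binary digits, least significant bit first. -/
def bitsVal (l : List Bool) : ℕ := Nat.ofDigits 2 (l.map Bool.toNat)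

/-- A description of one output bit: the positions of the input bits that it reads, and
its truth table as a function of these bits. -/
structure BitRule where
  pos : List ℕ
  table : List Bool

/-- The output bit on the input `g`. -/
def BitRule.eval (r : BitRule) (g : List Bool) : Bool :=
  r.table.getD (bitsVal (r.pos.map fun p => g.getD p false)) false

/-- A description of a map `{0,1}^inLen → {0,1}^m`: the number `inLen`, and a description of each
of the `m` output bits. -/
structure LocalMap where
  inLen : ℕ
  out : List BitRule

namespace LocalMap

/-- The map that is described. -/
def eval (D : LocalMap) (g : List Bool) : List Bool := D.out.map fun r => r.eval g

/-- Every output bit reads at most `k` input bits (and the description is well-formed). -/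
def HasLocality (D : LocalMap) (k : ℕ) : Prop :=
  ∀ r ∈ D.out, r.pos.length ≤ k ∧ (∀ p ∈ r.pos, p < D.inLen) ∧
    r.table.length = 2 ^ r.pos.length

/-- The alphabet in which descriptions are written. -/
inductive Token where
  | tick
  | sep
  | bit (b : Bool)
  | close
  deriving DecidableEq, Fintype

open Token

/-- A rule as a word: the positions (in unary, each closed by `sep`), then the table. -/
def ruleWord (r : BitRule) : List Token :=
  r.pos.flatMap (fun p => List.replicate p tick ++ [sep]) ++ (r.table.map bit ++ [close])

/-- A description as a word: `inLen` in unary, then the rules. -/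
def word (D : LocalMap) : List Token :=
  ruleWord ⟨[D.inLen], []⟩ ++ D.out.flatMap ruleWord

/-- Reading a word from right to left. -/
def readToken : Token → List BitRule → List BitRule
  | close, rs => ⟨[], []⟩ :: rs
  | bit b, ⟨p, t⟩ :: rs => ⟨p, b :: t⟩ :: rs
  | sep, ⟨p, t⟩ :: rs => ⟨0 :: p, t⟩ :: rs
  | tick, ⟨p :: ps, t⟩ :: rs => ⟨(p + 1) :: ps, t⟩ :: rs
  | _, rs => rs

/-- The description written in a word. -/
def unword (w : List Token) : Option LocalMap :=
  match w.foldr readToken [] with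
  | ⟨p :: _, _⟩ :: rs => some ⟨p, rs⟩
  | _ => none

theorem foldr_ticks (n p : ℕ) (ps : List ℕ) (t : List Bool) (rs : List BitRule) :
    (List.replicate n tick).foldr readToken (⟨p :: ps, t⟩ :: rs) = ⟨(p + n) :: ps, t⟩ :: rs := by
  induction n with
  | zero => simp
  | succ n ih => simp [List.replicate_succ, ih, readToken, Nat.add_assoc]

theorem foldr_table (t : List Bool) (rs : List BitRule) :
    (t.map bit).foldr readToken (⟨[], []⟩ :: rs) = ⟨[], t⟩ :: rs := by
  induction t with
  | nil => simp
  | cons b t ih => simp only [List.map_cons, List.foldr_cons, ih, readToken]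

theorem foldr_pos (ps : List ℕ) (t : List Bool) (rs : List BitRule) :
    (ps.flatMap (fun p => List.replicate p tick ++ [sep])).foldr readToken (⟨[], t⟩ :: rs) =
      ⟨ps, t⟩ :: rs := by
  induction ps with
  | nil => simp
  | cons p ps ih =>
    rw [List.flatMap_cons, List.foldr_append, ih, List.foldr_append]
    simp only [List.foldr_cons, List.foldr_nil, readToken]
    rw [foldr_ticks, Nat.zero_add]

theorem foldr_ruleWord (r : BitRule) (rs : List BitRule) :
    (ruleWord r).foldr readToken rs = r :: rs := by
  rw [ruleWord, List.foldr_append, List.foldr_append]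
  simp only [List.foldr_cons, List.foldr_nil, readToken]
  rw [foldr_table, foldr_pos]

/-- A description can be recovered from its word. -/
theorem unword_word (D : LocalMap) : unword D.word = some D := by
  have h : ∀ rs : List BitRule, (rs.flatMap ruleWord).foldr readToken [] = rs := by
    intro rs
    induction rs with
    | nil => simp
    | cons r rs ih => rw [List.flatMap_cons, List.foldr_append, ih, foldr_ruleWord]
  rw [unword, word, List.foldr_append, h, foldr_ruleWord]

end LocalMap

/-- Reading a word of `3 + w + 2 * ℓ` bits as a gate: three bits for the type, `w` bits for
the index of the variable (in the case of an input gate), and the labels, of `ℓ` bits each, of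
the first and second child (if there are any). -/
def decodeGate (w ℓ : ℕ) (o : List Bool) : Gate :=
  let l := (o.drop (3 + w)).take ℓ
  let r := (o.drop (3 + w + ℓ)).take ℓ
  match o.getD 0 false, o.getD 1 false, o.getD 2 false with
  | false, false, false => Gate.and l r
  | false, false, true => Gate.or l r
  | false, true, false => Gate.not l
  | false, true, true => Gate.copy l
  | true, false, _ => Gate.input (bitsVal ((o.drop 3).take w))
  | true, true, b => Gate.const b

/-- The type and the children that `D` outputs on input the label `g`, for circuits with
`n` input variables. -/
def LocalMap.gateAt (D : LocalMap) (n : ℕ) (g : List Bool) : Gate :=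
  decodeGate (Nat.size n) D.inLen (D.eval g)

/-! ### Output bits given by arbitrary functions of a few input bits -/

/-! The labels of the new circuits are configurations of a machine that explores the given circuits,
and a wire is one step of that machine. A step changes a configuration only locally, so the map from
a label to its children has constant locality although the wires of the given circuits need not be
local.

The machine (`Explorer.explorer`) has finitely many stacks of height `O(log n)`. A configuration in
a state `node κ` stands for a gate of kind `κ` of the given circuit. Its two successors start the
uniformity machine on the label of this gate, one in order to find each child. All intermediate
configurations are Copy gates with one child, the next configuration, so they pass on the value of
the child that is finally found (`Explorer.chain_child`, `StackMachine.Chain.evaluates`). Induction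
along the wires of the given circuit shows that every node has the right value
(`Explorer.evaluates_gateCfg`).

A configuration is written as a word of cells: the `j`-th cell holds the state and the `j`-th symbol
of every stack, counted from the top. The state and all topmost symbols are thus visible in the
first cell, and pushing or popping shifts a stack by one cell. A new cell depends on the first cell
and on three neighbouring cells (`StackMachine.automaton_succ`); with letters encoded in blocks of
constant width this is constant locality.

Strings that are not sensible configurations could lie on cycles. Each label therefore also contains
a clock that advances along every wire, and a gate whose clock overflows is a constant without
children. An ordinary counter is not local, since carries propagate; in the carry-save clock each
carry moves by one cell per step, yet the number represented grows by exactly one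
(`ClockCell.value_tick`). The clock never overflows on the gates of the circuit, because they are
reached along paths of distinct configurations and there are fewer of these than clock readings
(`StackMachine.ReachedAt.lt`).

The description of the map is regular: its truth tables are fixed and its positions are affine in
loop counters. A program with loops nested at most twice prints it, and such programs compile to
polynomial-time machines (`LoopProg.computableInPolyTime`). -/

theorem bitsVal_nil : bitsVal [] = 0 := rfl

theorem bitsVal_cons (b : Bool) (l : List Bool) :
    bitsVal (b :: l) = b.toNat + 2 * bitsVal l := by
  simp [bitsVal, Nat.ofDigits_cons]

theorem bitsVal_lt (l : List Bool) : bitsVal l < 2 ^ l.length := by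
  induction l with
  | nil => simp [bitsVal_nil]
  | cons b l ih =>
    rw [bitsVal_cons, List.length_cons, pow_succ]
    have := Bool.toNat_le b
    omega

theorem map_testBit_bitsVal (l : List Bool) :
    (List.range l.length).map (bitsVal l).testBit = l := by
  induction l with
  | nil => rfl
  | cons b l ih =>
    rw [List.length_cons, List.range_succ_eq_map, List.map_cons, List.map_map, bitsVal_cons]
    have h0 : (b.toNat + 2 * bitsVal l).testBit 0 = b := by cases b <;> simp
    have h1 : (b.toNat + 2 * bitsVal l).testBit ∘ Nat.succ = (bitsVal l).testBit := by
      funext i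
      have : (b.toNat + 2 * bitsVal l) / 2 = bitsVal l := by
        have := Bool.toNat_lt b
        omega
      simp [Nat.testBit_succ, this]
    rw [h0, h1, ih]

/-- The rule that reads the positions `pos` and applies `F` to the bits found there. -/
def BitRule.ofFun (pos : List ℕ) (F : List Bool → Bool) : BitRule :=
  ⟨pos, (List.range (2 ^ pos.length)).map fun v => F ((List.range pos.length).map v.testBit)⟩

theorem BitRule.eval_ofFun (pos : List ℕ) (F : List Bool → Bool) (g : List Bool) :
    (BitRule.ofFun pos F).eval g = F (pos.map fun p => g.getD p false) := by
  have h := bitsVal_lt (pos.map fun p => g.getD p false)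
  have h' := map_testBit_bitsVal (pos.map fun p => g.getD p false)
  rw [List.length_map] at h h'
  simp only [BitRule.eval, BitRule.ofFun]
  rw [List.getD_eq_getElem _ _ (by simpa using h)]
  simp only [List.getElem_map, List.getElem_range]
  rw [h']

/-! ### Words divided into blocks of equal length -/

/-- A code whose code words all have the same length. -/
structure BlockCode (A : Type) where
  width : ℕ
  enc : A → List Bool
  dec : List Bool → A
  length_enc : ∀ a, (enc a).length = width
  dec_enc : ∀ a, dec (enc a) = a

theorem BlockCode.nonempty (A : Type) [Finite A] [Nonempty A] : Nonempty (BlockCode A) := by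
  obtain ⟨m, ⟨e⟩⟩ := Finite.exists_equiv_fin A
  have hinj : Function.Injective fun a : A => List.ofFn fun i => decide (e a = i) := by
    intro a b h
    have := congrFun (List.ofFn_injective h) (e a)
    simpa [eq_comm] using this
  -- The decoder is total: a block that is no code word also stands for some letter, so every bit
  -- string can be read as a configuration.
  exact ⟨⟨m, _, Function.invFun _, fun a => by simp, Function.leftInverse_invFun hinj⟩⟩

namespace BlockCode

variable {A : Type} (B : BlockCode A)

/-- The positions of the `j`-th block. -/
def blockPos (j : ℕ) : List ℕ := (List.range B.width).map (j * B.width + ·)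

/-- The letter that is encoded in the `j`-th block of a word. -/
def letter (g : List Bool) (j : ℕ) : A := B.dec ((B.blockPos j).map fun p => g.getD p false)

/-- The word that encodes the first `S` letters of `u`. -/
def word (S : ℕ) (u : ℕ → A) : List Bool := (List.range S).flatMap fun j => B.enc (u j)

theorem length_word (S : ℕ) (u : ℕ → A) : (B.word S u).length = S * B.width := by
  simp [word, List.length_flatMap, B.length_enc]

theorem word_congr {S : ℕ} {u v : ℕ → A} (h : ∀ j < S, u j = v j) :
    B.word S u = B.word S v := by
  unfold word
  rw [List.flatMap_def, List.flatMap_def]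
  congr 1
  exact List.map_congr_left fun j hj => by rw [h j (List.mem_range.1 hj)]

theorem word_succ (S : ℕ) (u : ℕ → A) : B.word (S + 1) u = B.word S u ++ B.enc (u S) := by
  simp [word, List.range_succ]

theorem letter_word {S : ℕ} (u : ℕ → A) {j : ℕ} (hj : j < S) : B.letter (B.word S u) j = u j := by
  have key : ((B.blockPos j).map fun p => (B.word S u).getD p false) = B.enc (u j) := by
    induction S with
    | zero => omega
    | succ S ih =>
      rw [word_succ]
      rcases Nat.lt_succ_iff_lt_or_eq.1 hj with h | rfl
      · rw [← ih h]
        refine List.map_congr_left fun p hp => ?_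
        obtain ⟨w, hw, rfl⟩ := List.mem_map.1 hp
        refine List.getD_append _ _ _ _ ?_
        rw [length_word]
        have hw := List.mem_range.1 hw
        have : (j + 1) * B.width ≤ S * B.width := Nat.mul_le_mul_right _ h
        rw [Nat.add_mul] at this
        omega
      · refine List.ext_getElem (by simp [blockPos, B.length_enc]) fun i h1 h2 => ?_
        simp only [blockPos, List.getElem_map, List.getElem_range]
        rw [List.getD_append_right _ _ _ _ (by rw [length_word]; omega), length_word,
          Nat.add_sub_cancel_left, List.getD_eq_getElem _ _ h2]
  rw [letter, key, B.dec_enc]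

/-- Reading a word as a sequence of `k` blocks. -/
def unblock : ℕ → List Bool → List A
  | 0, _ => []
  | k + 1, l => B.dec (l.take B.width) :: unblock k (l.drop B.width)

theorem length_blockPos (j : ℕ) : (B.blockPos j).length = B.width := by simp [blockPos]

theorem length_flatMap_blockPos (cells : List ℕ) :
    (cells.flatMap B.blockPos).length = cells.length * B.width := by
  simp [List.length_flatMap, length_blockPos]

theorem unblock_map (g : List Bool) (cells : List ℕ) :
    B.unblock cells.length ((cells.flatMap B.blockPos).map fun p => g.getD p false) =
      cells.map (B.letter g) := by
  induction cells with
  | nil => rfl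
  | cons j cells ih =>
    rw [List.length_cons, unblock, List.flatMap_cons, List.map_append, List.map_cons]
    have h : ((B.blockPos j).map fun p => g.getD p false).length = B.width := by
      rw [List.length_map, length_blockPos]
    rw [List.take_left' h, List.drop_left' h, ih, letter]

/-- The rule that reads the blocks `cells` and applies `F` to the letters found there. -/
def rule (cells : List ℕ) (F : List A → Bool) : BitRule :=
  BitRule.ofFun (cells.flatMap B.blockPos) fun l => F (B.unblock cells.length l)

theorem eval_rule (cells : List ℕ) (F : List A → Bool) (g : List Bool) :
    (B.rule cells F).eval g = F (cells.map (B.letter g)) := by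
  rw [rule, BitRule.eval_ofFun, unblock_map]

/-- The rules that read the blocks `cells` and print the code word of the value of `F`
on the letters found there. -/
def rules (cells : List ℕ) (F : List A → A) : List BitRule :=
  (List.range B.width).map fun w => B.rule cells fun l => (B.enc (F l)).getD w false

theorem eval_rules (cells : List ℕ) (F : List A → A) (g : List Bool) :
    (B.rules cells F).map (fun r => r.eval g) = B.enc (F (cells.map (B.letter g))) := by
  refine List.ext_getElem (by simp [rules, B.length_enc]) fun i h1 h2 => ?_
  simp only [rules, List.getElem_map, List.getElem_range, eval_rule]
  rw [List.getD_eq_getElem _ _ h2]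

/-- A rule is well-formed on words of `S` blocks, and reads at most `k` blocks. -/
def Fits (S k : ℕ) (r : BitRule) : Prop :=
  ∃ cells F, r = B.rule cells F ∧ cells.length ≤ k ∧ ∀ j ∈ cells, j < S

theorem Fits.locality {S k : ℕ} {r : BitRule} (h : B.Fits S k r) :
    r.pos.length ≤ k * B.width ∧ (∀ p ∈ r.pos, p < S * B.width) ∧
      r.table.length = 2 ^ r.pos.length := by
  obtain ⟨cells, F, rfl, hk, hS⟩ := h
  refine ⟨?_, fun p hp => ?_, by simp [rule, BitRule.ofFun]⟩
  · simp only [rule, BitRule.ofFun]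
    rw [length_flatMap_blockPos]
    exact Nat.mul_le_mul_right _ hk
  · obtain ⟨j, hj, hp⟩ := List.mem_flatMap.1 hp
    obtain ⟨w, hw, rfl⟩ := List.mem_map.1 hp
    have hw := List.mem_range.1 hw
    have : (j + 1) * B.width ≤ S * B.width := Nat.mul_le_mul_right _ (hS j hj)
    rw [Nat.add_mul] at this
    omega

theorem fits_rules {S k : ℕ} {cells : List ℕ} (F : List A → A) (hk : cells.length ≤ k)
    (hS : ∀ j ∈ cells, j < S) : ∀ r ∈ B.rules cells F, B.Fits S k r := by
  intro r hr
  obtain ⟨w, -, rfl⟩ := List.mem_map.1 hr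
  exact ⟨_, _, rfl, hk, hS⟩

end BlockCode

/-! ### Gate types -/

/-- The type of a gate, without the index of the variable. -/
inductive Kind where
  | and | or | not | copy | input
  | const (b : Bool)
  deriving DecidableEq, Fintype

namespace Kind

/-- The three bits that encode the type. -/
def bits : Kind → List Bool
  | and => [false, false, false]
  | or => [false, false, true]
  | not => [false, true, false]
  | copy => [false, true, true]
  | input => [true, false, false]
  | const b => [true, true, b]

theorem length_bits (κ : Kind) : κ.bits.length = 3 := by cases κ <;> rfl

/-- The gate of the given type, with the given index and children where they are needed. -/
def toGate (i : ℕ) (l r : List Bool) : Kind → Gate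
  | and => .and l r
  | or => .or l r
  | not => .not l
  | copy => .copy l
  | input => .input i
  | const b => .const b

end Kind

theorem decodeGate_append (κ : Kind) {w ℓ : ℕ} {ib l r : List Bool} (hi : ib.length = w)
    (hl : l.length = ℓ) (hr : r.length = ℓ) :
    decodeGate w ℓ (κ.bits ++ ib ++ l ++ r) = κ.toGate (bitsVal ib) l r := by
  have h3 := κ.length_bits
  have e1 : ((κ.bits ++ ib ++ l ++ r).drop (3 + w)).take ℓ = l := by
    rw [List.append_assoc (κ.bits ++ ib), List.drop_left' (by simp [h3, hi]), List.take_left' hl]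
  have e2 : ((κ.bits ++ ib ++ l ++ r).drop (3 + w + ℓ)).take ℓ = r := by
    rw [List.drop_left' (by simp [h3, hi, hl]; omega), List.take_of_length_le hr.le]
  have e3 : ((κ.bits ++ ib ++ l ++ r).drop 3).take w = ib := by
    rw [List.append_assoc, List.append_assoc, List.drop_left' h3, List.take_left' hi]
  unfold decodeGate
  rw [e1, e2, e3]
  cases κ with
  | const b => cases b <;> rfl
  | _ => rfl

/-! ### Local maps that perform one step of a cellular automaton -/

/-- A cellular automaton on a segment, in which each cell sees its two neighbours (if they exist)
and the first cell.  A configuration has two successors, one for each Boolean value.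
A configuration is the label of a gate, whose type is determined by the first cell. -/
structure Automaton (A : Type) where
  next : Bool → A → Option A → A → Option A → A
  kind : A → Kind
  idx : A → Bool

namespace Automaton

variable {A : Type} (U : Automaton A)

/-- A successor of a configuration of `S` cells. -/
def succ (S : ℕ) (s : Bool) (u : ℕ → A) (j : ℕ) : A :=
  U.next s (u 0) (if j = 0 then none else some (u (j - 1))) (u j)
    (if j + 1 < S then some (u (j + 1)) else none)

variable (B : BlockCode A)

/-- The new content of the first cell as a function of the first two cells. -/
def firstFun (s : Bool) (l : List A) : A :=
  match l with
  | [a, b] => U.next s a none a (some b)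
  | _ => B.dec []

/-- The new content of a cell as a function of the first cell and the neighbourhood. -/
def midFun (s : Bool) (l : List A) : A :=
  match l with
  | [a, b, c, d] => U.next s a (some b) c (some d)
  | _ => B.dec []

/-- The new content of the last cell as a function of the first cell and the last two cells. -/
def lastFun (s : Bool) (l : List A) : A :=
  match l with
  | [a, b, c] => U.next s a (some b) c none
  | _ => B.dec []

/-- The rules for the cells between the first and the last. -/
def midRules (a : ℕ) (s : Bool) (i : ℕ) : List BitRule :=
  (List.range a).flatMap fun e =>
    B.rules [0, a * i + e, a * i + (e + 1), a * i + (e + 2)] (U.midFun B s)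

/-- The rules that compute a successor of a configuration of `a * L + a + 2` cells. -/
def succRules (a L : ℕ) (s : Bool) : List BitRule :=
  B.rules [0, 1] (U.firstFun B s) ++ (List.range (L + 1)).flatMap (U.midRules B a s) ++
    B.rules [0, a * L + a, a * L + (a + 1)] (U.lastFun B s)

theorem eval_midRules (a S : ℕ) (s : Bool) (i : ℕ) (g : List Bool) (h : a * i + a + 2 ≤ S) :
    (U.midRules B a s i).map (fun r => r.eval g) =
      (List.range a).flatMap fun e => B.enc (U.succ S s (B.letter g) (a * i + e + 1)) := by
  rw [midRules, List.map_flatMap, List.flatMap_def, List.flatMap_def]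
  congr 1
  refine List.map_congr_left fun e he => ?_
  have he := List.mem_range.1 he
  rw [B.eval_rules]
  congr 1
  simp only [List.map_cons, List.map_nil, midFun, succ]
  rw [if_neg (by omega), if_pos (by omega)]
  rfl

theorem flatMap_range_mul {X : Type} (F : ℕ → List X) (a k : ℕ) :
    (List.range k).flatMap (fun i => (List.range a).flatMap fun e => F (a * i + e)) =
      (List.range (a * k)).flatMap F := by
  induction k with
  | zero => simp
  | succ k ih =>
    rw [List.range_succ, List.flatMap_append, ih, Nat.mul_succ, List.range_add]
    simp [List.flatMap_map]

/-- The first and the last cell lack a neighbour and have rules of their own. The `a * (L + 1)`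
cells between them come in `L + 1` groups of `a`, so that a loop controlled by `L` can print their
rules. -/
theorem eval_succRules (a L : ℕ) (s : Bool) (g : List Bool) :
    (U.succRules B a L s).map (fun r => r.eval g) =
      B.word (a * L + a + 2) (U.succ (a * L + a + 2) s (B.letter g)) := by
  rw [succRules, List.map_append, List.map_append, List.map_flatMap, B.eval_rules, B.eval_rules,
    BlockCode.word_succ, BlockCode.word, List.range_succ_eq_map (n := a * L + a),
    List.flatMap_cons, List.flatMap_map]
  congr 1
  · congr 1
    rw [← Nat.mul_succ, ← flatMap_range_mul, List.flatMap_def, List.flatMap_def]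
    congr 1
    refine List.map_congr_left fun i hi => ?_
    have hi := List.mem_range.1 hi
    have : a * (i + 1) ≤ a * (L + 1) := Nat.mul_le_mul_left _ hi
    rw [Nat.mul_succ] at this
    exact U.eval_midRules B a _ s i g (by rw [Nat.mul_succ] at *; omega)
  · congr 1
    simp only [List.map_cons, List.map_nil, lastFun, succ]
    rw [if_neg (by omega), if_neg (by omega)]
    rfl

/-- The rules that print the type of the gate. -/
def kindRules : List BitRule :=
  (List.range 3).map fun t =>
    B.rule [0] fun l => (U.kind (l.headD (B.dec []))).bits.getD t false

/-- The rules that print the index of the variable. -/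
def idxRules (L : ℕ) : List BitRule :=
  (List.range L).map fun j => B.rule [j] fun l => U.idx (l.headD (B.dec []))

/-- The map that sends a configuration to the type, the index and the two successors. -/
def localMap (a L : ℕ) : LocalMap where
  inLen := (a * L + a + 2) * B.width
  out := U.kindRules B ++ U.idxRules B L ++ U.succRules B a L false ++ U.succRules B a L true

theorem eval_localMap (a L : ℕ) (g : List Bool) :
    (U.localMap B a L).eval g =
      (U.kind (B.letter g 0)).bits ++ (List.range L).map (fun j => U.idx (B.letter g j)) ++
        B.word (a * L + a + 2) (U.succ (a * L + a + 2) false (B.letter g)) ++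
        B.word (a * L + a + 2) (U.succ (a * L + a + 2) true (B.letter g)) := by
  rw [LocalMap.eval, localMap, List.map_append, List.map_append, List.map_append, eval_succRules,
    eval_succRules]
  congr 3
  · refine List.ext_getElem (by simp [kindRules, Kind.length_bits]) fun i h1 h2 => ?_
    simp only [kindRules, List.getElem_map, List.getElem_range, B.eval_rule]
    simp [List.getElem?_eq_getElem h2]
  · simp [idxRules, B.eval_rule]

theorem gateAt_localMap (a n : ℕ) (g : List Bool) :
    (U.localMap B a n.size).gateAt n g =
      (U.kind (B.letter g 0)).toGate
        (bitsVal ((List.range n.size).map fun j => U.idx (B.letter g j)))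
        (B.word (a * n.size + a + 2) (U.succ (a * n.size + a + 2) false (B.letter g)))
        (B.word (a * n.size + a + 2) (U.succ (a * n.size + a + 2) true (B.letter g))) := by
  rw [LocalMap.gateAt, eval_localMap]
  exact decodeGate_append _ (by simp) (B.length_word _ _) (B.length_word _ _)

/-- No output bit needs more than four cells. The hypothesis `1 ≤ a` ensures that the `L` cells from
which the index is read exist. -/
theorem hasLocality_localMap (a L : ℕ) (ha : 1 ≤ a) :
    (U.localMap B a L).HasLocality (4 * B.width) := by
  suffices h : ∀ r ∈ (U.localMap B a L).out, B.Fits (a * L + a + 2) 4 r from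
    fun r hr => (h r hr).locality
  have hs : ∀ s, ∀ r ∈ U.succRules B a L s, B.Fits (a * L + a + 2) 4 r := by
    intro s r hr
    rw [succRules, List.mem_append, List.mem_append] at hr
    rcases hr with (hr | hr) | hr
    · exact B.fits_rules _ (by simp) (by simp) r hr
    · obtain ⟨i, hi, hr⟩ := List.mem_flatMap.1 hr
      obtain ⟨e, he, hr⟩ := List.mem_flatMap.1 hr
      have hi := List.mem_range.1 hi
      have he := List.mem_range.1 he
      have : a * (i + 1) ≤ a * (L + 1) := Nat.mul_le_mul_left _ hi
      rw [Nat.mul_succ, Nat.mul_succ] at this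
      refine B.fits_rules _ (by simp) ?_ r hr
      simp only [List.mem_cons, List.not_mem_nil, or_false]
      rintro j (rfl | rfl | rfl | rfl) <;> omega
    · refine B.fits_rules _ (by simp) ?_ r hr
      simp only [List.mem_cons, List.not_mem_nil, or_false]
      rintro j (rfl | rfl | rfl) <;> omega
  intro r hr
  simp only [localMap, List.mem_append] at hr
  rcases hr with ((hr | hr) | hr) | hr
  · obtain ⟨t, -, rfl⟩ := List.mem_map.1 hr
    exact ⟨_, _, rfl, by simp, by simp⟩
  · obtain ⟨j, hj, rfl⟩ := List.mem_map.1 hr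
    have hj := List.mem_range.1 hj
    have : 1 * L ≤ a * L := Nat.mul_le_mul_right _ ha
    exact ⟨_, _, rfl, by simp, by simp; omega⟩
  · exact hs _ r hr
  · exact hs _ r hr

theorem length_localMap_out (a L : ℕ) :
    (U.localMap B a L).out.length = 3 + L + 2 * ((a * L + a + 2) * B.width) := by
  have h := congrArg List.length (U.eval_localMap B a L [])
  simp only [LocalMap.eval, List.length_append, List.length_map, Kind.length_bits, B.length_word,
    List.length_range] at h
  omega

end Automaton

/-! ### A clock in carry-save representation -/

/-- A digit in base `b + 1` and a carry. -/
abbrev ClockCell (b : ℕ) := Fin (b + 1) × Bool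

namespace ClockCell

variable {b : ℕ}

/-- Adding the carry of the cell to the right. -/
def step (c : ClockCell b) (r : Bool) : ClockCell b :=
  (⟨(c.1 + r.toNat) % (b + 1), Nat.mod_lt _ b.succ_pos⟩, decide (b + 1 ≤ c.1 + r.toNat))

/-- A digit is at most `b` and the incoming carry at most `1`, so a single outgoing carry absorbs
any overflow. -/
theorem step_val (c : ClockCell b) (r : Bool) :
    ((c.step r).1 : ℕ) + (b + 1) * (c.step r).2.toNat = c.1 + r.toNat := by
  have h1 := c.1.2
  have h2 := Bool.toNat_le r
  simp only [step]
  by_cases h : b + 1 ≤ c.1 + r.toNat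
  · have : (c.1 : ℕ) + r.toNat = b + 1 := by omega
    simp [this]
  · rw [Nat.mod_eq_of_lt (by omega)]
    simp [h]

/-- One tick of a clock of `S` cells, whose leading digit comes first. -/
def tick (S : ℕ) (u : ℕ → ClockCell b) (j : ℕ) : ClockCell b :=
  (u j).step (if j + 1 < S then (u (j + 1)).2 else true)

/-- The number that the first `k` cells represent. -/
def value (u : ℕ → ClockCell b) : ℕ → ℕ
  | 0 => 0
  | k + 1 => (b + 1) * value u k + ((u k).1 + (b + 1) * (u k).2.toNat)

theorem value_congr {u v : ℕ → ClockCell b} {k : ℕ} (h : ∀ j < k, u j = v j) :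
    value u k = value v k := by
  induction k with
  | zero => rfl
  | succ k ih => rw [value, value, ih fun j hj => h j (by omega), h k (by omega)]

/-- A carry waiting in a cell is worth `b + 1` units of that cell, which is one unit of the cell to
its left; moving it there preserves the total. The value of a prefix changes only by the carry that
enters from cell `k` and the one that is lost at cell `0`. -/
theorem value_tick_aux (S : ℕ) (u : ℕ → ClockCell b) {k : ℕ} (hk : k < S) :
    value (tick S u) k + (u 0).2.toNat * (b + 1) ^ k = value u k + (u k).2.toNat := by
  induction k with
  | zero => simp [value]
  | succ k ih =>
    have h := ih (by omega)
    have e : tick S u k = (u k).step (u (k + 1)).2 := by rw [tick, if_pos hk]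
    rw [value, value, e, step_val]
    calc _ = (b + 1) * (value (tick S u) k + (u 0).2.toNat * (b + 1) ^ k) +
          ((u k).1 + (u (k + 1)).2.toNat) := by ring
      _ = _ := by rw [h]; ring

/-- The carry fed into the last cell at each tick accounts for the summand `1`. -/
theorem value_tick {S : ℕ} (hS : 0 < S) (u : ℕ → ClockCell b) :
    value (tick S u) S + (u 0).2.toNat * (b + 1) ^ S = value u S + 1 := by
  obtain ⟨k, rfl⟩ := Nat.exists_eq_succ_of_ne_zero hS.ne'
  have h := value_tick_aux (k + 1) u k.lt_succ_self
  have e : tick (k + 1) u k = (u k).step true := by rw [tick, if_neg (by omega)]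
  rw [Nat.succ_eq_add_one, value, value, e, step_val]
  calc _ = (b + 1) * (value (tick (k + 1) u) k + (u 0).2.toNat * (b + 1) ^ k) +
        ((u k).1 + true.toNat) := by ring
    _ = _ := by rw [h]; simp only [Bool.toNat_true]; ring

theorem le_value {S : ℕ} (hS : 0 < S) {u : ℕ → ClockCell b} (h : (u 0).2 = true) :
    (b + 1) ^ S ≤ value u S := by
  induction S with
  | zero => omega
  | succ k ih =>
    rw [value]
    rcases k.eq_zero_or_pos with rfl | hk
    · rw [zero_add, pow_one, h, Bool.toNat_true]; omega
    · calc (b + 1) ^ (k + 1) = (b + 1) * (b + 1) ^ k := pow_succ' _ _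
        _ ≤ (b + 1) * value u k := Nat.mul_le_mul_left _ (ih hk)
        _ ≤ _ := Nat.le_add_right _ _

theorem value_le (u : ℕ → ClockCell b) (k : ℕ) : value u k ≤ (2 * b + 2) ^ k * (2 * b + 2) := by
  -- A cell contributes at most `b + (b + 1)`. The extra summand on the left makes the crude bound
  -- inductive.
  suffices h : value u k + (2 * b + 1) ≤ (2 * b + 2) ^ k * (2 * b + 2) by omega
  induction k with
  | zero => simp [value]
  | succ k ih =>
    have h1 := (u k).1.2
    have h2 : (b + 1) * (u k).2.toNat ≤ (b + 1) * 1 :=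
      Nat.mul_le_mul_left _ (Bool.toNat_le _)
    rw [value, pow_succ]
    have h3 : (2 * b + 2) * (value u k + (2 * b + 1)) ≤
      (2 * b + 2) ^ k * (2 * b + 2) * (2 * b + 2) := by
      rw [mul_comm]; exact Nat.mul_le_mul_right _ ih
    nlinarith

/-- The clock after `t` ticks. -/
def clockAt (b S : ℕ) : ℕ → ℕ → ClockCell b
  | 0 => fun _ => (0, false)
  | t + 1 => tick S (clockAt b S t)

/-- Until then nothing is lost: a carry in the first cell alone is worth `(b + 1) ^ S`, by
`le_value`. -/
theorem value_clockAt {S : ℕ} (hS : 0 < S) {t : ℕ} (ht : t ≤ (b + 1) ^ S) :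
    value (clockAt b S t) S = t := by
  induction t with
  | zero =>
    have : ∀ k, value (clockAt b S 0) k = 0 := by
      intro k
      induction k with
      | zero => rfl
      | succ k ih => rw [value, ih]; simp [clockAt]
    exact this S
  | succ t ih =>
    have h := ih (by omega)
    have hc : (clockAt b S t 0).2 = false := by
      by_contra hc
      have := le_value hS (Bool.not_eq_false _ ▸ hc : (clockAt b S t 0).2 = true)
      omega
    have := value_tick hS (clockAt b S t)
    rw [hc, h, Bool.toNat_false, zero_mul] at this
    exact this

theorem clockAt_carry {S : ℕ} (hS : 0 < S) {t : ℕ} (ht : t < (b + 1) ^ S) :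
    (clockAt b S t 0).2 = false := by
  by_contra hc
  have := le_value hS (Bool.not_eq_false _ ▸ hc : (clockAt b S t 0).2 = true)
  rw [value_clockAt hS ht.le] at this
  omega

end ClockCell

/-! ### Automata equipped with a clock -/

namespace Automaton

variable {A : Type} (U : Automaton A)

/-- The automaton with a clock, which stops when there is a carry in the first cell. -/
def clocked (b : ℕ) : Automaton (A × ClockCell b) where
  next s a l c r := (U.next s a.1 (l.map Prod.fst) c.1 (r.map Prod.fst),
    -- A missing right neighbour marks the last cell, which receives a carry in every step.
    c.2.step (r.elim true fun d => d.2.2))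
  kind a := if a.2.2 then .const false else U.kind a.1
  idx a := U.idx a.1

theorem clocked_succ (b S : ℕ) (s : Bool) (u : ℕ → A × ClockCell b) (j : ℕ) :
    (U.clocked b).succ S s u j =
      (U.succ S s (fun j => (u j).1) j, ClockCell.tick S (fun j => (u j).2) j) := by
  simp only [succ, clocked, ClockCell.tick]
  congr 2
  · split_ifs <;> rfl
  · split_ifs <;> rfl
  · split_ifs <;> rfl

end Automaton

theorem Kind.mem_children_toGate {κ : Kind} {i : ℕ} {l r c : List Bool}
    (h : c ∈ (κ.toGate i l r).children) : (c = l ∨ c = r) ∧ ∀ b, κ ≠ .const b := by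
  cases κ <;> simp_all [Kind.toGate, Gate.children]

namespace Automaton

variable {A : Type} (U : Automaton A) {b : ℕ} (B : BlockCode (A × ClockCell b))

/-- The time shown in a label. -/
def time (S : ℕ) (g : List Bool) : ℕ := ClockCell.value (fun j => (B.letter g j).2) S

/-- A string with a child is not a constant gate, so its first cell holds no carry and no part of
the clock value is lost. Nothing is assumed about `g`, since every string decodes to cells. -/
theorem time_child {a n : ℕ} {g c : List Bool}
    (h : c ∈ (((U.clocked b).localMap B a n.size).gateAt n g).children) :
    time B (a * n.size + a + 2) c = time B (a * n.size + a + 2) g + 1 := by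
  rw [gateAt_localMap] at h
  obtain ⟨h, hk⟩ := Kind.mem_children_toGate h
  have hc : (B.letter g 0).2.2 = false := by
    by_contra hc
    exact hk false (by simp [clocked, Bool.not_eq_false _ ▸ hc])
  have key : ∀ s, time B (a * n.size + a + 2) (B.word (a * n.size + a + 2)
      ((U.clocked b).succ (a * n.size + a + 2) s (B.letter g))) =
        time B (a * n.size + a + 2) g + 1 := by
    intro s
    have h1 := ClockCell.value_tick (S := a * n.size + a + 2) (by omega)
      fun j => (B.letter g j).2
    rw [hc, Bool.toNat_false, zero_mul, add_zero] at h1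
    rw [time, time, ← h1]
    refine ClockCell.value_congr fun j hj => ?_
    rw [B.letter_word _ hj, clocked_succ]
  rcases h with rfl | rfl <;> exact key _

theorem transGen_time {a n : ℕ} {g h : List Bool} {P : List Bool → Prop}
    (hgh : Relation.TransGen (fun x y => P x ∧
      y ∈ (((U.clocked b).localMap B a n.size).gateAt n x).children) g h) :
    time B (a * n.size + a + 2) g < time B (a * n.size + a + 2) h := by
  induction hgh with
  | single h => rw [U.time_child B h.2]; omega
  | tail _ h ih => rw [U.time_child B h.2]; omega

/-- Time grows along wires and is bounded by `ClockCell.value_le`, so the remaining time decreases.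
-/
theorem wellFounded_children (a n : ℕ) (P : List Bool → Prop) :
    WellFounded fun c g => P g ∧
      c ∈ (((U.clocked b).localMap B a n.size).gateAt n g).children := by
  refine Subrelation.wf (r := InvImage (· < ·) fun g =>
    (2 * b + 2) ^ (a * n.size + a + 2) * (2 * b + 2) - time B (a * n.size + a + 2) g) ?_
    (InvImage.wf _ wellFounded_lt)
  intro c g h
  have h1 := U.time_child B h.2
  have h2 := ClockCell.value_le (fun j => (B.letter c j).2) (a * n.size + a + 2)
  simp only [InvImage]
  rw [time] at h1
  rw [time]
  omega

end Automaton

/-! ### Stack machines with branching -/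

/-- What can happen to a stack in one step. -/
inductive StackOp (ι Γ : Type) where
  | keep
  | push (a : Γ)
  | pop
  | copy (i : ι) (m : Γ → Γ)
  | clear

/-- The new content of the stack `i`. -/
def StackOp.apply {ι Γ : Type} (S : ι → List Γ) (i : ι) : StackOp ι Γ → List Γ
  | keep => S i
  | push a => a :: S i
  | pop => (S i).tail
  | copy j m => (S j).map m
  | clear => []

/-- A machine with several stacks, which acts on all of them in each step, depending on its
state and on the topmost symbols.  A configuration has two successors and is the label of a gate,
whose type is determined by the state; the index of the variable is read from a stack. -/
structure StackMachine (Q ι Γ : Type) where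
  act : Bool → Q → (ι → Option Γ) → Q × (ι → StackOp ι Γ)
  kind : Q → Kind
  idxStack : ι
  idxBit : Γ → Bool

namespace StackMachine

variable {Q ι Γ : Type} (M : StackMachine Q ι Γ)

/-- A state and the contents of the stacks. -/
abbrev Cfg (_ : StackMachine Q ι Γ) := Q × (ι → List Γ)

/-- A successor of a configuration. -/
def succ (s : Bool) (c : M.Cfg) : M.Cfg :=
  let r := M.act s c.1 fun i => (c.2 i).head?
  (r.1, fun i => (r.2 i).apply c.2 i)

/-- The index of the variable that is read in a configuration. -/
def index (c : M.Cfg) : ℕ := bitsVal ((c.2 M.idxStack).map M.idxBit)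

/-- The successors that are the children of a configuration. -/
def sides (κ : Kind) : List Bool :=
  match κ with
  | .and => [false, true]
  | .or => [false, true]
  | .not => [false]
  | .copy => [false]
  | .input => []
  | .const _ => []

/-- The value of a gate as a function of the values of the two successors. -/
def evalKind (x : List Bool) (i : ℕ) (v : Bool → Bool) : Kind → Bool
  | .and => v false && v true
  | .or => v false || v true
  | .not => !(v false)
  | .copy => v false
  | .input => x.getD i false
  | .const b => b

/-- The configuration evaluates to the given bit on the input `x`, where all stacks have height
at most `S`, and indices of variables have at most `L` bits. -/
inductive Evaluates (S L : ℕ) (x : List Bool) : M.Cfg → Bool → Prop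
  | intro (c : M.Cfg) (v : Bool → Bool) (height : ∀ i, (c.2 i).length ≤ S)
    (index : M.kind c.1 = .input → (c.2 M.idxStack).length ≤ L ∧ M.index c < x.length)
    (children : ∀ s ∈ sides (M.kind c.1), Evaluates S L x (M.succ s c) (v s)) :
    Evaluates S L x c (evalKind x (M.index c) v (M.kind c.1))

/-- The second configuration is a child of the first. -/
def Child (d c : M.Cfg) : Prop := ∃ s ∈ sides (M.kind c.1), d = M.succ s c

/-- The configuration evaluates to some bit. -/
def Valid (S L n : ℕ) (c : M.Cfg) : Prop := ∃ b, M.Evaluates S L (List.replicate n false) c b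

variable {M} in
theorem Valid.height {S L n : ℕ} {c : M.Cfg} (h : M.Valid S L n c) :
    ∀ i, (c.2 i).length ≤ S := by
  obtain ⟨_, h⟩ := h
  cases h with
  | intro _ v hh hi hc => exact hh

variable {M} in
theorem Valid.index_lt {S L n : ℕ} {c : M.Cfg} (h : M.Valid S L n c) (hk : M.kind c.1 = .input) :
    (c.2 M.idxStack).length ≤ L ∧ M.index c < n := by
  obtain ⟨_, h⟩ := h
  cases h with
  | intro _ v hh hi hc => simpa using hi hk

variable {M} in
theorem Valid.child {S L n : ℕ} {c d : M.Cfg} (h : M.Valid S L n c) (hd : M.Child d c) :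
    M.Valid S L n d := by
  obtain ⟨_, h⟩ := h
  obtain ⟨s, hs, rfl⟩ := hd
  cases h with
  | intro _ v hh hi hc => exact ⟨_, hc s hs⟩

variable {M} in
-- A derivation of `Evaluates` is a finite tree that contains derivations for all children.
theorem Valid.acc {S L n : ℕ} {c : M.Cfg} (h : M.Valid S L n c) : Acc M.Child c := by
  obtain ⟨_, h⟩ := h
  induction h with
  | intro c v hh hi hc ih =>
    refine ⟨_, ?_⟩
    rintro _ ⟨s, hs, rfl⟩
    exact ih s hs

variable {M} in
theorem Valid.not_transGen {S L n : ℕ} {c : M.Cfg} (h : M.Valid S L n c) :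
    ¬ Relation.TransGen M.Child c c := by
  have h := h.acc.transGen
  induction h with
  | intro c _ ih => exact fun hc => ih c hc ‹_› hc

/-! ### The automaton of a stack machine -/

/-- The part of a configuration that is stored in one cell. -/
abbrev Cell (Q ι Γ : Type) := Q × (ι → Option Γ)

/-- The `j`-th cell of a configuration. -/
def cell (c : M.Cfg) (j : ℕ) : Cell Q ι Γ := (c.1, fun i => (c.2 i)[j]?)

/-- The new content of a stack in one cell. -/
def cellOp (l : Option (Cell Q ι Γ)) (c : Cell Q ι Γ) (r : Option (Cell Q ι Γ)) (i : ι) :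
    StackOp ι Γ → Option Γ
  | .keep => c.2 i
  | .push a => l.elim (some a) fun d => d.2 i
  | .pop => r.bind fun d => d.2 i
  | .copy j m => (c.2 j).map m
  | .clear => none

/-- The automaton that works on the cells of a configuration. -/
def automaton : Automaton (Cell Q ι Γ) where
  next s a l c r := ((M.act s a.1 a.2).1, fun i => cellOp l c r i ((M.act s a.1 a.2).2 i))
  kind a := M.kind a.1
  idx a := (a.2 M.idxStack).any M.idxBit

/-- Pushing and popping are shifts by one cell, and the other operations act cell by cell. The
height bound matters for popping: the last cell becomes empty for want of a neighbour, which is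
right only if the stack has no symbol beyond it. -/
theorem automaton_succ {S : ℕ} {c : M.Cfg} (h : ∀ i, (c.2 i).length ≤ S) (s : Bool) (j : ℕ) :
    M.automaton.succ S s (M.cell c) j = M.cell (M.succ s c) j := by
  have h0 : (fun i => (c.2 i)[0]?) = fun i => (c.2 i).head? :=
    funext fun i => List.head?_eq_getElem?.symm
  simp only [Automaton.succ, automaton, cell, h0, succ]
  congr 1
  funext i
  cases (M.act s c.1 fun i => (c.2 i).head?).2 i with
  | keep => rfl
  | push a =>
    cases j <;> simp [cellOp, StackOp.apply]
  | pop =>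
    by_cases hj : j + 1 < S
    · simp [cellOp, StackOp.apply, hj]
    · have : (c.2 i)[j + 1]? = none := List.getElem?_eq_none (by have := h i; omega)
      simp [cellOp, StackOp.apply, hj, this]
  | copy k m => simp [cellOp, StackOp.apply]
  | clear => simp [cellOp, StackOp.apply]

theorem cell_injective {S : ℕ} (hS : 0 < S) {c d : M.Cfg} (hc : ∀ i, (c.2 i).length ≤ S)
    (hd : ∀ i, (d.2 i).length ≤ S) (h : ∀ j < S, M.cell c j = M.cell d j) : c = d := by
  have h0 : c.1 = d.1 := (Prod.mk.inj (h 0 hS)).1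
  refine Prod.ext h0 (funext fun i => List.ext_getElem? fun j => ?_)
  rcases lt_or_ge j S with hj | hj
  · exact congrFun (Prod.mk.inj (h j hj)).2 i
  · rw [List.getElem?_eq_none ((hc i).trans hj), List.getElem?_eq_none ((hd i).trans hj)]

/-- The cells below the bottom of the stack contribute zeros in the most significant positions. -/
theorem bitsVal_idx {l : List Γ} {L : ℕ} (h : l.length ≤ L) (p : Γ → Bool) :
    bitsVal ((List.range L).map fun j => (l[j]?).any p) = bitsVal (l.map p) := by
  induction l generalizing L with
  | nil =>
    simp only [List.getElem?_nil, Option.any_none, List.map_nil, bitsVal_nil]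
    clear h
    induction L with
    | zero => rfl
    | succ L ih =>
      rw [List.range_succ_eq_map, List.map_cons, List.map_map, bitsVal_cons]
      simpa [Function.comp_def] using ih
  | cons a l ih =>
    obtain ⟨L, rfl⟩ := Nat.exists_eq_add_one_of_ne_zero (n := L) (by
      rw [List.length_cons] at h; omega)
    rw [List.range_succ_eq_map, List.map_cons, List.map_map, bitsVal_cons, List.map_cons,
      bitsVal_cons, ← ih (by simpa using h)]
    simp [Function.comp_def]

/-! ### The circuit of a stack machine -/

section Circuit

variable {b : ℕ} (B : BlockCode (Cell Q ι Γ × ClockCell b)) (a n : ℕ)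

/-- The label of a configuration at time `t`. -/
def label (t : ℕ) (c : M.Cfg) : List Bool :=
  B.word (a * n.size + a + 2) fun j => (M.cell c j, ClockCell.clockAt b (a * n.size + a + 2) t j)

/-- The local map for circuits with `n` input variables. -/
def gateMap : LocalMap := (M.automaton.clocked b).localMap B a n.size

variable {a n}

/-- As long as there is no carry in the first cell, the clock does not replace the type of the gate
by a constant, and the two halves of each cell evolve independently. -/
theorem gateAt_label {t : ℕ} {c : M.Cfg} (ha : 1 ≤ a)
    (hh : ∀ i, (c.2 i).length ≤ a * n.size + a + 2)
    (hi : M.kind c.1 = .input → (c.2 M.idxStack).length ≤ n.size)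
    (ht : (ClockCell.clockAt b (a * n.size + a + 2) t 0).2 = false) :
    (M.gateMap B a n).gateAt n (M.label B a n t c) =
      (M.kind c.1).toGate (M.index c) (M.label B a n (t + 1) (M.succ false c))
        (M.label B a n (t + 1) (M.succ true c)) := by
  have hL : 1 * n.size ≤ a * n.size := Nat.mul_le_mul_right _ ha
  have h0 : B.letter (M.label B a n t c) 0 = _ := B.letter_word _ (by omega)
  have hs : ∀ s, B.word (a * n.size + a + 2) ((M.automaton.clocked b).succ (a * n.size + a + 2) s
      (B.letter (M.label B a n t c))) = M.label B a n (t + 1) (M.succ s c) := by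
    intro s
    refine B.word_congr fun j hj => ?_
    have e : (M.automaton.clocked b).succ (a * n.size + a + 2) s
        (B.letter (M.label B a n t c)) j = (M.automaton.clocked b).succ (a * n.size + a + 2) s
          (fun j => (M.cell c j, ClockCell.clockAt b (a * n.size + a + 2) t j)) j := by
      rw [Automaton.succ, Automaton.succ]
      have hl : ∀ k < a * n.size + a + 2, B.letter (M.label B a n t c) k = _ :=
        fun k hk => B.letter_word _ hk
      rw [hl 0 (by omega), hl j hj, hl (j - 1) (by omega)]
      by_cases hj' : j + 1 < a * n.size + a + 2
      · rw [hl (j + 1) hj']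
      · rw [if_neg hj', if_neg hj']
    rw [e, Automaton.clocked_succ, M.automaton_succ hh]
    rfl
  rw [gateMap, Automaton.gateAt_localMap, hs, hs, h0]
  have hk : (M.automaton.clocked b).kind
      (M.cell c 0, ClockCell.clockAt b (a * n.size + a + 2) t 0) = M.kind c.1 := by
    simp [Automaton.clocked, ht, automaton, cell]
  rw [hk]
  by_cases hinp : M.kind c.1 = .input
  · congr 1
    rw [index, ← bitsVal_idx (hi hinp)]
    congr 1
    refine List.map_congr_left fun j hj => ?_
    have hj := List.mem_range.1 hj
    rw [label, B.letter_word _ (by omega)]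
    rfl
  · cases hk' : M.kind c.1 <;> first | exact absurd hk' hinp | rfl

/-- A configuration is reached at time `t` along a path of `t` different configurations. -/
def ReachedAt (S L n t : ℕ) (c : M.Cfg) : Prop :=
  M.Valid S L n c ∧ ∃ l : List M.Cfg, l.Nodup ∧ l.length = t ∧
    ∀ d ∈ l, M.Valid S L n d ∧ Relation.TransGen M.Child c d

variable {M} in
theorem ReachedAt.child {S L t : ℕ} {c d : M.Cfg} (h : M.ReachedAt S L n t c)
    (hd : M.Child d c) : M.ReachedAt S L n (t + 1) d := by
  obtain ⟨hc, l, hl, rfl, hr⟩ := h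
  refine ⟨hc.child hd, c :: l, List.nodup_cons.2 ⟨fun hm => hc.not_transGen (hr c hm).2, hl⟩, rfl,
    fun e he => ?_⟩
  rcases List.mem_cons.1 he with rfl | he
  · exact ⟨hc, .single hd⟩
  · exact ⟨(hr e he).1, .head hd (hr e he).2⟩

variable {M} in
-- Pigeonhole: `c` and its `t` predecessors are distinct, and each is determined by its first `S`
-- cells. The bound is the capacity of a clock with one digit more than there are cell contents.
theorem ReachedAt.lt [Finite Q] [Finite ι] [Finite Γ] {S L t : ℕ} (hS : 0 < S) {c : M.Cfg}
    (h : M.ReachedAt S L n t c) : t < (Nat.card (Cell Q ι Γ) + 1) ^ S := by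
  obtain ⟨hc, l, hl, rfl, hr⟩ := h
  have hl' : (c :: l).Nodup := List.nodup_cons.2 ⟨fun hm => hc.not_transGen (hr c hm).2, hl⟩
  have hh : ∀ d ∈ c :: l, ∀ i, (d.2 i).length ≤ S := fun d hd => by
    rcases List.mem_cons.1 hd with rfl | hd
    · exact hc.height
    · exact (hr d hd).1.height
  have hn : ((c :: l).map fun d => fun j : Fin S => M.cell d j).Nodup := by
    refine List.Nodup.map_on (fun d hd e he hde => ?_) hl'
    exact M.cell_injective hS (hh d hd) (hh e he) fun j hj => congrFun hde ⟨j, hj⟩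
  have := Fintype.ofFinite (Cell Q ι Γ)
  classical
  have hlen := hn.length_le_card
  rw [← Nat.card_eq_fintype_card, Nat.card_fun, Nat.card_eq_fintype_card (α := Fin S),
    Fintype.card_fin, List.length_map, List.length_cons] at hlen
  calc l.length < Nat.card (Cell Q ι Γ) ^ S := hlen
    _ ≤ _ := Nat.pow_le_pow_left (Nat.le_succ _) _

variable (a n) in
/-- The labels that can be reached from the label of a configuration. -/
def reachable (c : M.Cfg) : Set (List Bool) :=
  {g | Relation.ReflTransGen
    (fun g h => h ∈ ((M.gateMap B a n).gateAt n g).children) (M.label B a n 0 c) g}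

end Circuit

/-! ### The circuit formed by the reachable labels -/

section

variable [Finite Q] [Finite ι] [Finite Γ]
  (B : BlockCode (Cell Q ι Γ × ClockCell (Nat.card (Cell Q ι Γ)))) {a n : ℕ}

theorem gateAt_label_of_reachedAt {t : ℕ} {c : M.Cfg} (ha : 1 ≤ a)
    (h : M.ReachedAt (a * n.size + a + 2) n.size n t c) :
    (M.gateMap B a n).gateAt n (M.label B a n t c) =
      (M.kind c.1).toGate (M.index c) (M.label B a n (t + 1) (M.succ false c))
        (M.label B a n (t + 1) (M.succ true c)) :=
  M.gateAt_label B ha h.1.height (fun hk => (h.1.index_lt hk).1)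
    (ClockCell.clockAt_carry (by omega) (h.lt (by omega)))

/-- Induction along the path: `ReachedAt` keeps the clock from overflowing, so the next label is
again that of a genuine successor, with one more predecessor. -/
theorem exists_reachedAt {c₀ : M.Cfg} (ha : 1 ≤ a)
    (hc : M.Valid (a * n.size + a + 2) n.size n c₀) {g : List Bool}
    (hg : g ∈ M.reachable B a n c₀) :
    ∃ t c, g = M.label B a n t c ∧ M.ReachedAt (a * n.size + a + 2) n.size n t c := by
  induction hg with
  | refl => exact ⟨0, c₀, rfl, hc, [], List.nodup_nil, rfl, by simp⟩
  | @tail _ d _ h ih =>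
    obtain ⟨t, c, rfl, hr⟩ := ih
    rw [M.gateAt_label_of_reachedAt B ha hr] at h
    have key : ∃ s ∈ sides (M.kind c.1), d = M.label B a n (t + 1) (M.succ s c) := by
      cases hk : M.kind c.1 <;> simp_all [Kind.toGate, Gate.children, sides]
    obtain ⟨s, hs, rfl⟩ := key
    exact ⟨t + 1, _, rfl, hr.child ⟨s, hs, rfl⟩⟩

theorem length_of_reachable {c₀ : M.Cfg} (ha : 1 ≤ a)
    (hc : M.Valid (a * n.size + a + 2) n.size n c₀) {g : List Bool}
    (hg : g ∈ M.reachable B a n c₀) : g.length = (a * n.size + a + 2) * B.width := by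
  obtain ⟨t, c, rfl, -⟩ := M.exists_reachedAt B ha hc hg
  exact B.length_word _ _

theorem finite_reachable {c₀ : M.Cfg} (ha : 1 ≤ a)
    (hc : M.Valid (a * n.size + a + 2) n.size n c₀) : (M.reachable B a n c₀).Finite :=
  (List.finite_length_eq Bool _).subset fun _ hg => M.length_of_reachable B ha hc hg

/-- The circuit that evaluates a configuration. -/
noncomputable def circuit {c₀ : M.Cfg} (ha : 1 ≤ a)
    (hc : M.Valid (a * n.size + a + 2) n.size n c₀) : Circuit n where
  len := (a * n.size + a + 2) * B.width
  gates := (M.finite_reachable B ha hc).toFinset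
  length_eq g hg := M.length_of_reachable B ha hc ((Set.Finite.mem_toFinset _).1 hg)
  gate := (M.gateMap B a n).gateAt n
  input_lt g hg i hi := by
    obtain ⟨t, c, rfl, hr⟩ := M.exists_reachedAt B ha hc ((Set.Finite.mem_toFinset _).1 hg)
    rw [M.gateAt_label_of_reachedAt B ha hr] at hi
    cases hk : M.kind c.1 <;> rw [hk] at hi <;> simp only [Kind.toGate, reduceCtorEq] at hi
    cases hi
    exact (hr.1.index_lt hk).2
  child_mem g hg d hd := by
    rw [Set.Finite.mem_toFinset] at hg ⊢
    exact hg.tail hd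
  acyclic := M.automaton.wellFounded_children B a n _
  out := M.label B a n 0 c₀
  out_mem := (Set.Finite.mem_toFinset _).2 .refl

theorem card_circuit_le {c₀ : M.Cfg} (ha : 1 ≤ a)
    (hc : M.Valid (a * n.size + a + 2) n.size n c₀) :
    (M.circuit B ha hc).size ≤ 2 ^ ((a * n.size + a + 2) * B.width) := by
  classical
  have h : (M.circuit B ha hc).gates ⊆ (Finset.univ : Finset (List.Vector Bool
      ((a * n.size + a + 2) * B.width))).image List.Vector.toList := fun g hg =>
    Finset.mem_image.2 ⟨⟨g, (M.circuit B ha hc).length_eq g hg⟩, Finset.mem_univ _, rfl⟩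
  refine (Finset.card_le_card h).trans (Finset.card_image_le.trans ?_)
  simp

/-- Induction on the derivation of `Evaluates`. The time is arbitrary, because a configuration may
occur with several clock readings. -/
theorem circuit_val {c₀ : M.Cfg} (ha : 1 ≤ a)
    (hc : M.Valid (a * n.size + a + 2) n.size n c₀) {x : List Bool} (hx : x.length = n)
    {c : M.Cfg} {v : Bool} (h : M.Evaluates (a * n.size + a + 2) n.size x c v) (t : ℕ)
    (ht : M.label B a n t c ∈ (M.circuit B ha hc).gates) :
    (M.circuit B ha hc).val x (M.label B a n t c) = v := by
  induction h generalizing t with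
  | intro c v hh hi _ ih =>
    have hcar : (ClockCell.clockAt (Nat.card (Cell Q ι Γ)) (a * n.size + a + 2) t 0).2 = false := by
      -- Membership yields a possibly different pair with the same label; the carry in the first
      -- cell can be read off the label, so its absence carries over.
      obtain ⟨t', c', e, hr⟩ := M.exists_reachedAt B ha hc ((Set.Finite.mem_toFinset _).1 ht)
      have := congrArg (fun g => (B.letter g 0).2.2) e
      simp only [label] at this
      rw [B.letter_word _ (by omega), B.letter_word _ (by omega)] at this
      rw [this]
      exact ClockCell.clockAt_carry (by omega) (hr.lt (by omega))
    have e : (M.circuit B ha hc).gate (M.label B a n t c) = _ :=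
      M.gateAt_label B ha hh (fun hk => (hi hk).1) hcar
    have hmem := (M.circuit B ha hc).child_mem _ ht
    rw [Circuit.val_eq _ _ ht]
    rw [e] at hmem ⊢
    cases hk : M.kind c.1 <;> rw [hk] at hmem ih <;>
      simp only [Kind.toGate, Gate.children, sides, List.mem_cons, List.not_mem_nil, or_false,
        forall_eq_or_imp, forall_eq] at hmem ih <;>
      simp_all [Kind.toGate, Gate.eval, evalKind]

end

end StackMachine

/-! ### Loop programs that print words -/

/-- A program that prints a word over `T`.  A loop at depth `d` is executed as many times as
the counter of depth `d` says, with the counter of depth `d + 1` as its variable. -/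
inductive LoopProg (T : Type) where
  | emit (w : List T)
  | seq (p q : LoopProg T)
  | loop (p : LoopProg T)

namespace LoopProg

variable {T : Type}

/-- The word that is printed if the counter has the value `m`. -/
def output : LoopProg T → ℕ → List T
  | emit w, _ => w
  | seq p q, m => output p m ++ output q m
  | loop p, m => (List.range m).flatMap (output p)

/-- The depth to which loops are nested. -/
def depth : LoopProg T → ℕ
  | emit _ => 0
  | seq p q => max (depth p) (depth q)
  | loop p => depth p + 1

/-- A bound on the number of steps, if no counter exceeds `R`. -/
def cost : LoopProg T → ℕ → ℕ
  | emit _, _ => 1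
  | seq p q, R => cost p R + cost q R
  | loop p, R => (R + 1) + R * (1 + cost p R) + 1

/-- The bound is a polynomial. -/
noncomputable def costPoly : LoopProg T → Polynomial ℕ
  | emit _ => 1
  | seq p q => costPoly p + costPoly q
  | loop p => (.X + 1) + .X * (1 + costPoly p) + 1

theorem eval_costPoly (p : LoopProg T) (R : ℕ) : p.costPoly.eval R = p.cost R := by
  induction p with
  | emit w => simp [costPoly, cost]
  | seq p q ihp ihq => simp [costPoly, cost, ihp, ihq]
  | loop p ih => simp [costPoly, cost, ih]

/-- The labels of the compiled program. -/
def Label : LoopProg T → Type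
  | emit _ => Unit
  | seq p q => Label p ⊕ Label q
  | loop p => Bool ⊕ Label p

instance finite_label : (p : LoopProg T) → Finite p.Label
  | emit _ => inferInstanceAs (Finite Unit)
  | seq p q => by
    have := finite_label p
    have := finite_label q
    exact inferInstanceAs (Finite (Label p ⊕ Label q))
  | loop p => by
    have := finite_label p
    exact inferInstanceAs (Finite (Bool ⊕ Label p))

/-- The label at which the execution starts. -/
def start : (p : LoopProg T) → p.Label
  | emit _ => ()
  -- The second program runs first: pushing onto the output stack builds the word from its end.
  | seq _ q => Sum.inr q.start
  | loop _ => Sum.inl false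

/-- The stacks of the machine: its input, its output and the counters. -/
inductive StackName where
  | inp
  | out
  | counter (i : Fin 3)
  deriving DecidableEq, Fintype

/-- The counter of depth `d`. -/
def StackName.ofDepth (d : ℕ) : StackName := .counter (Fin.ofNat 3 d)

/-- The stack alphabets. -/
def StackName.Alphabet (T : Type) : StackName → Type
  | .inp => Bool
  | .out => T
  | .counter _ => Unit

open Turing TM2 Stmt

/-- The statements of a machine with labels `X`. -/
abbrev PStmt (T X : Type) := TM2.Stmt (StackName.Alphabet T) X Bool

/-- Putting a word on the output stack. -/
def pushWord {X : Type} : List T → PStmt T X → PStmt T X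
  | [], q => q
  | a :: w, q => pushWord w (push .out (fun _ => a) q)

/-- Decreasing a counter if possible, and a jump to `q` or `r` depending on success. -/
def decrease {X : Type} (d : ℕ) (q r : PStmt T X) : PStmt T X :=
  pop (.ofDepth d) (fun _ a => a.isSome) (branch id q r)

/-- Increasing a counter. -/
def increase {X : Type} (d : ℕ) (q : PStmt T X) : PStmt T X :=
  push (.ofDepth d) (fun _ => ()) q

/-- The compiled program at depth `d`, as a part of a machine with labels `X`, which continues
at the label `e`. -/
def code {X : Type} : (p : LoopProg T) → (d : ℕ) → (p.Label → X) → X → p.Label → PStmt T X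
  | emit w, _, _, e => fun _ => pushWord w (goto fun _ => e)
  | seq p q, d, φ, e => Sum.elim (code p d (fun l => φ (.inl l)) e)
      (code q d (fun l => φ (.inr l)) (φ (.inl p.start)))
  | loop p, d, φ, e => Sum.elim
      -- At `inl false` counter `d` is emptied into counter `d + 1`. At `inl true` one unit is moved
      -- back before each pass, so the loop variable descends to `0` and counter `d` is restored at
      -- the end.
      (fun b => bif b
        then decrease (d + 1) (increase d (goto fun _ => φ (.inr p.start))) (goto fun _ => e)
        else decrease d (increase (d + 1) (goto fun _ => φ (.inl false)))
          (goto fun _ => φ (.inl true)))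
      (code p (d + 1) (fun l => φ (.inr l)) (φ (.inl true)))

/-- The contents of the stacks, when the input has been read. -/
def contents (ρ : ℕ → ℕ) (o : List T) : (k : StackName) → List (StackName.Alphabet T k)
  | .inp => []
  | .out => o
  | .counter i => List.replicate (ρ i) ()

theorem contents_ofDepth {d : ℕ} (hd : d < 3) (ρ : ℕ → ℕ) (o : List T) :
    contents ρ o (.ofDepth d) = List.replicate (ρ d) () := by
  have : ((Fin.ofNat 3 d : Fin 3) : ℕ) = d := Nat.mod_eq_of_lt hd
  simp only [StackName.ofDepth, contents, this]
  rfl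

theorem update_contents {d : ℕ} (hd : d < 3) (ρ : ℕ → ℕ) (o : List T) (m : ℕ) :
    Function.update (contents ρ o) (.ofDepth d) (List.replicate m ()) =
      contents (Function.update ρ d m) o := by
  have hd' : ((Fin.ofNat 3 d : Fin 3) : ℕ) = d := Nat.mod_eq_of_lt hd
  funext k
  by_cases hk : k = .ofDepth d
  · subst hk
    rw [Function.update_self, contents_ofDepth hd, Function.update_self]
    rfl
  · rw [Function.update_of_ne hk]
    cases k with
    | inp => rfl
    | out => rfl
    | counter i =>
      have : (i : ℕ) ≠ d := by
        rintro rfl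
        exact hk (by simp [StackName.ofDepth])
      simp only [contents, Function.update_of_ne this]

theorem update_contents_out (ρ : ℕ → ℕ) (o o' : List T) :
    Function.update (contents ρ o) .out o' = contents ρ o' := by
  funext k
  cases k <;> rfl

/-! ### Execution of compiled loop programs -/

section Run

variable {X : Type}

theorem stepAux_pushWord (w : List T) (q : PStmt T X) (v : Bool) (ρ : ℕ → ℕ) (o : List T) :
    stepAux (pushWord w q) v (contents ρ o) = stepAux q v (contents ρ (w ++ o)) := by
  induction w generalizing q with
  | nil => rfl
  | cons a w ih =>
    rw [pushWord, ih]
    exact congrArg (stepAux q v) (update_contents_out ρ (w ++ o) (a :: (w ++ o)))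

theorem stepAux_increase {d : ℕ} (hd : d < 3) (q : PStmt T X) (v : Bool) (ρ : ℕ → ℕ)
    (o : List T) :
    stepAux (increase d q) v (contents ρ o) =
      stepAux q v (contents (Function.update ρ d (ρ d + 1)) o) := by
  exact (congrArg (fun l => stepAux q v (Function.update (contents ρ o) (.ofDepth d) (() :: l)))
    (contents_ofDepth hd ρ o)).trans (congrArg (stepAux q v) (update_contents hd ρ o (ρ d + 1)))

theorem stepAux_decrease (d : ℕ) (q r : PStmt T X) (v : Bool) {ρ : ℕ → ℕ} (o : List T)
    {l : List (StackName.Alphabet T (.ofDepth d))} (h : contents ρ o (.ofDepth d) = l) :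
    stepAux (decrease d q r) v (contents ρ o) = cond l.head?.isSome
      (stepAux q l.head?.isSome (Function.update (contents ρ o) (.ofDepth d) l.tail))
      (stepAux r l.head?.isSome (Function.update (contents ρ o) (.ofDepth d) l.tail)) := by
  subst h
  rfl

theorem stepAux_decrease_zero {d : ℕ} (hd : d < 3) (q r : PStmt T X) (v : Bool) {ρ : ℕ → ℕ}
    (o : List T) (h : ρ d = 0) :
    stepAux (decrease d q r) v (contents ρ o) = stepAux r false (contents ρ o) := by
  have e : Function.update (contents ρ o) (.ofDepth d) (List.replicate 0 ()) = contents ρ o := by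
    rw [update_contents hd, ← h, Function.update_eq_self]
  rw [stepAux_decrease d q r v o (l := List.replicate 0 ())
    ((contents_ofDepth hd ρ o).trans (congrArg (List.replicate · ()) h))]
  exact congrArg (stepAux r false) e

theorem stepAux_decrease_succ {d : ℕ} (hd : d < 3) (q r : PStmt T X) (v : Bool) {ρ : ℕ → ℕ}
    (o : List T) {m : ℕ} (h : ρ d = m + 1) :
    stepAux (decrease d q r) v (contents ρ o) =
      stepAux q true (contents (Function.update ρ d m) o) := by
  rw [stepAux_decrease d q r v o (l := List.replicate (m + 1) ())
    ((contents_ofDepth hd ρ o).trans (congrArg (List.replicate · ()) h)),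
    ← update_contents hd]
  rfl

/-- The configuration `c'` is reached from `c` in at most `t` steps. -/
def ReachesIn (μ : X → PStmt T X) (t : ℕ) (c c' : TM2.Cfg (StackName.Alphabet T) X Bool) : Prop :=
  ∃ k ≤ t, (flip bind (TM2.step μ))^[k] (some c) = some c'

theorem ReachesIn.trans {μ : X → PStmt T X} {t₁ t₂ : ℕ}
    {c₁ c₂ c₃ : TM2.Cfg (StackName.Alphabet T) X Bool} (h₁ : ReachesIn μ t₁ c₁ c₂)
    (h₂ : ReachesIn μ t₂ c₂ c₃) : ReachesIn μ (t₁ + t₂) c₁ c₃ := by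
  obtain ⟨k₁, hk₁, e₁⟩ := h₁
  obtain ⟨k₂, hk₂, e₂⟩ := h₂
  exact ⟨k₂ + k₁, by omega, by rw [Function.iterate_add_apply, e₁, e₂]⟩

theorem ReachesIn.step {μ : X → PStmt T X} {l : X} {v : Bool}
    {S : (k : StackName) → List (StackName.Alphabet T k)}
    {c : TM2.Cfg (StackName.Alphabet T) X Bool} (h : stepAux (μ l) v S = c) :
    ReachesIn μ 1 ⟨some l, v, S⟩ c := ⟨1, le_rfl, congrArg some h⟩

theorem ReachesIn.mono {μ : X → PStmt T X} {t₁ t₂ : ℕ}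
    {c₁ c₂ : TM2.Cfg (StackName.Alphabet T) X Bool} (h : ReachesIn μ t₁ c₁ c₂) (ht : t₁ ≤ t₂) :
    ReachesIn μ t₂ c₁ c₂ := by
  obtain ⟨k, hk, e⟩ := h
  exact ⟨k, hk.trans ht, e⟩

theorem reachesIn_fill {μ : X → PStmt T X} {d : ℕ} (hd : d + 1 < 3) {l e : X}
    (hl : μ l = decrease d (increase (d + 1) (goto fun _ => l)) (goto fun _ => e))
    (ρ : ℕ → ℕ) (o : List T) (v : Bool) :
    ReachesIn μ (ρ d + 1) ⟨some l, v, contents ρ o⟩ ⟨some e, false,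
      contents (Function.update (Function.update ρ d 0) (d + 1) (ρ (d + 1) + ρ d)) o⟩ := by
  induction h : ρ d generalizing ρ v with
  | zero =>
    refine ReachesIn.step ?_
    rw [hl, stepAux_decrease_zero (by omega) _ _ _ _ h, stepAux, ← h, Function.update_eq_self,
      h, add_zero, Function.update_eq_self]
  | succ m ih =>
    set ρ' := Function.update (Function.update ρ d m) (d + 1) (ρ (d + 1) + 1) with hρ'
    have h1 : ReachesIn μ 1 ⟨some l, v, contents ρ o⟩ ⟨some l, true, contents ρ' o⟩ := by
      refine ReachesIn.step ?_
      rw [hl, stepAux_decrease_succ (by omega) _ _ _ _ h, stepAux_increase hd, stepAux,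
        Function.update_of_ne (by omega)]
    have h2 := ih ρ' true (by rw [hρ', Function.update_of_ne (by omega), Function.update_self])
    have e1 : Function.update (Function.update ρ' d 0) (d + 1) (ρ' (d + 1) + m) =
        Function.update (Function.update ρ d 0) (d + 1) (ρ (d + 1) + (m + 1)) := by
      funext j
      simp only [hρ', Function.update_apply]
      split_ifs <;> omega
    rw [e1] at h2
    exact (h1.trans h2).mono (by omega)

/-- The invariant is `k + i = ρ d`: there are `i` passes left, and `k` units have been moved back.
The loop variable decreases while each pass prints in front of the earlier output, so the pieces end
up in increasing order. -/
theorem reachesIn_test {μ : X → PStmt T X} {d : ℕ} (hd : d + 1 < 3) {l s e : X}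
    (hl : μ l = decrease (d + 1) (increase d (goto fun _ => s)) (goto fun _ => e))
    {ρ : ℕ → ℕ} (hρ : ∀ j > d, ρ j = 0) {f : ℕ → List T} {c : ℕ}
    (hs : ∀ (ρ' : ℕ → ℕ) (o : List T) (v : Bool), (∀ j > d + 1, ρ' j = 0) → ρ' (d + 1) ≤ ρ d →
      ∃ v', ReachesIn μ c ⟨some s, v, contents ρ' o⟩
        ⟨some l, v', contents ρ' (f (ρ' (d + 1)) ++ o)⟩)
    (i k : ℕ) (o : List T) (v : Bool) (hk : k + i = ρ d) :
    ReachesIn μ (i * (1 + c) + 1)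
      ⟨some l, v, contents (Function.update (Function.update ρ d k) (d + 1) i) o⟩
      ⟨some e, false, contents ρ ((List.range i).flatMap f ++ o)⟩ := by
  induction i generalizing k o v with
  | zero =>
    rw [zero_mul, zero_add]
    refine ReachesIn.step ?_
    rw [hl, stepAux_decrease_zero hd _ _ _ _ (Function.update_self ..), stepAux]
    have e1 : Function.update (Function.update ρ d k) (d + 1) 0 = ρ := by
      funext j
      have := hρ (d + 1) (by omega)
      simp only [Function.update_apply]
      split_ifs with h1 h2
      · rw [h1, this]
      · rw [h2, ← hk, add_zero]
      · rfl
    rw [e1]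
    rfl
  | succ i ih =>
    set ρ' := Function.update (Function.update ρ d (k + 1)) (d + 1) i with hρ'
    have h1 : ReachesIn μ 1
        ⟨some l, v, contents (Function.update (Function.update ρ d k) (d + 1) (i + 1)) o⟩
        ⟨some s, true, contents ρ' o⟩ := by
      refine ReachesIn.step ?_
      rw [hl, stepAux_decrease_succ hd _ _ _ _ (Function.update_self ..),
        stepAux_increase (by omega), stepAux]
      congr 2
      funext j
      simp only [hρ', Function.update_apply]
      split_ifs <;> omega
    obtain ⟨v', h2⟩ := hs ρ' o true (fun j hj => by
      rw [hρ', Function.update_of_ne (by omega), Function.update_of_ne (by omega)]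
      exact hρ j (by omega)) (by rw [hρ', Function.update_self]; omega)
    rw [show ρ' (d + 1) = i from Function.update_self ..] at h2
    have h3 := ih (k + 1) (f i ++ o) v' (by omega)
    rw [List.range_succ, List.flatMap_append, List.flatMap_singleton, List.append_assoc]
    refine ((h1.trans h2).trans h3).mono (le_of_eq ?_)
    ring

/-- The induction works because a program leaves all counters as it found them, and finds the deeper
ones at zero, free for its own loops. -/
theorem reachesIn_code {μ : X → PStmt T X} (p : LoopProg T) {d : ℕ} {φ : p.Label → X} {e : X}
    (hμ : ∀ l, μ (φ l) = p.code d φ e l) (hd : d + p.depth < 3) {ρ : ℕ → ℕ}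
    (hρ : ∀ j > d, ρ j = 0) (o : List T) {R : ℕ} (hR : ρ d ≤ R) (v : Bool) :
    ∃ v', ReachesIn μ (p.cost R) ⟨some (φ p.start), v, contents ρ o⟩
      ⟨some e, v', contents ρ (p.output (ρ d) ++ o)⟩ := by
  induction p generalizing d e ρ o v with
  | emit w =>
    refine ⟨v, ReachesIn.step ?_⟩
    rw [hμ, code, stepAux_pushWord]
    rfl
  | seq p q ihp ihq =>
    rw [depth] at hd
    obtain ⟨v₁, h₁⟩ := ihq (φ := fun l => φ (.inr l)) (e := φ (.inl p.start))
      (fun l => hμ (.inr l)) (by omega) hρ o hR v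
    obtain ⟨v₂, h₂⟩ := ihp (φ := fun l => φ (.inl l)) (e := e)
      (fun l => hμ (.inl l)) (by omega) hρ (q.output (ρ d) ++ o) hR v₁
    refine ⟨v₂, ?_⟩
    rw [output, List.append_assoc, cost, add_comm]
    exact h₁.trans h₂
  | loop p ih =>
    rw [depth] at hd
    have hfill := reachesIn_fill (by omega) (hμ (.inl false)) ρ o v
    rw [hρ (d + 1) (by omega), zero_add] at hfill
    have htest := reachesIn_test (by omega) (hμ (.inl true)) hρ (f := p.output) (c := p.cost R)
      (fun ρ' o v hρ' hR' => ih (φ := fun l => φ (.inr l)) (e := φ (.inl true)) (d := d + 1)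
        (fun l => hμ (.inr l)) (by omega) hρ' o (hR'.trans hR) v) (ρ d) 0 o false (zero_add _)
    refine ⟨false, (hfill.trans htest).mono ?_⟩
    rw [cost]
    have : ρ d * (1 + p.cost R) ≤ R * (1 + p.cost R) := Nat.mul_le_mul_right _ hR
    omega

end Run

/-! ### The machine that prints the output of a loop program -/

/-- The labels of the machine: `inl false` for reading the input, `inl true` for the end. -/
abbrev MLabel (p : LoopProg T) : Type := Bool ⊕ p.Label

/-- The statements of the machine. -/
def mainCode (p : LoopProg T) : p.MLabel → PStmt T p.MLabel :=
  Sum.elim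
    (fun b => bif b
      then decrease 0 (goto fun _ => .inl true) halt
      else pop .inp (fun _ a => Option.isSome a) (branch id
        (increase 0 (goto fun _ => .inl false)) (goto fun _ => .inr p.start)))
    (p.code 0 .inr (.inl true))

/-- The machine. -/
noncomputable def machine (p : LoopProg T) : FinTM2 :=
  have : Fintype p.Label := Fintype.ofFinite _
  { K := StackName
    k₀ := .inp
    k₁ := .out
    Γ := StackName.Alphabet T
    Λ := p.MLabel
    main := .inl false
    σ := Bool
    initialState := false
    Γk₀Fin := inferInstanceAs (Fintype Bool)
    m := p.mainCode }

theorem reachesIn_read (p : LoopProg T) (w : List Bool) (ρ : ℕ → ℕ) (v : Bool) :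
    ReachesIn p.mainCode (w.length + 1)
      ⟨some (.inl false), v, Function.update (contents ρ []) .inp w⟩
      ⟨some (.inr p.start), false, contents (Function.update ρ 0 (ρ 0 + w.length)) []⟩ := by
  induction w generalizing ρ v with
  | nil =>
    refine ReachesIn.step ?_
    rw [List.length_nil, add_zero, Function.update_eq_self]
    refine congrArg (TM2.Cfg.mk _ _) (funext fun k => ?_)
    cases k <;> rfl
  | cons a w ih =>
    have h1 : ReachesIn p.mainCode 1
        ⟨some (.inl false), v, Function.update (contents ρ []) .inp (a :: w)⟩
        ⟨some (.inl false), true,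
          Function.update (contents (Function.update ρ 0 (ρ 0 + 1)) []) .inp w⟩ := by
      refine ReachesIn.step ?_
      refine congrArg (TM2.Cfg.mk _ _) (funext fun k => ?_)
      rcases k with _ | _ | i
      · rfl
      · rfl
      · fin_cases i <;> rfl
    have h2 := h1.trans (ih (Function.update ρ 0 (ρ 0 + 1)) true)
    rw [Function.update_self, Function.update_idem, add_assoc, add_comm 1 w.length] at h2
    exact h2.mono (by rw [List.length_cons]; omega)

theorem reachesIn_clear (p : LoopProg T) (ρ : ℕ → ℕ) (o : List T) (v : Bool) :
    ReachesIn p.mainCode (ρ 0 + 1) ⟨some (.inl true), v, contents ρ o⟩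
      ⟨none, false, contents (Function.update ρ 0 0) o⟩ := by
  induction h : ρ 0 generalizing ρ v with
  | zero =>
    refine ReachesIn.step ?_
    have e : Function.update ρ 0 0 = ρ := by rw [Function.update_eq_self_iff, h]
    rw [mainCode, Sum.elim_inl, cond_true, stepAux_decrease_zero (by omega) _ _ _ _ h, e]
    rfl
  | succ m ih =>
    have h1 : ReachesIn p.mainCode 1 ⟨some (.inl true), v, contents ρ o⟩
        ⟨some (.inl true), true, contents (Function.update ρ 0 m) o⟩ := by
      refine ReachesIn.step ?_
      rw [mainCode, Sum.elim_inl, cond_true, stepAux_decrease_succ (by omega) _ _ _ _ h]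
      rfl
    have h2 := ih (Function.update ρ 0 m) true (Function.update_self ..)
    rw [Function.update_idem] at h2
    exact (h1.trans h2).mono (by omega)

/-- The three summands are for counting the input, running the program and clearing counter `0`; a
halting configuration must have all stacks empty except the output. -/
theorem machine_outputs (p : LoopProg T) (hp : p.depth ≤ 2) (w : List Bool) :
    ReachesIn p.mainCode ((w.length + 1) + p.cost w.length + (w.length + 1))
      (initList p.machine w) (haltList p.machine (p.output w.length)) := by
  set ρ : ℕ → ℕ := Function.update (fun _ => 0) 0 w.length with hρ
  have h1 := p.reachesIn_read w (fun _ => 0) false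
  rw [zero_add] at h1
  obtain ⟨v, h2⟩ := p.reachesIn_code (μ := p.mainCode) (d := 0) (φ := .inr) (e := .inl true)
    (fun _ => rfl) (by omega) (ρ := ρ) (fun j hj => Function.update_of_ne (by omega) _ _) []
    (R := w.length) (Function.update_self (f := fun _ => 0) ..).le false
  have h3 := p.reachesIn_clear ρ (p.output (ρ 0) ++ []) v
  have e0 : ρ 0 = w.length := Function.update_self ..
  rw [e0] at h2 h3
  have h := (h1.trans h2).trans h3
  have ei : initList p.machine w =
      ⟨some (.inl false), false, Function.update (contents (fun _ => 0) []) .inp w⟩ := by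
    refine congrArg (TM2.Cfg.mk _ _) (funext fun k => ?_)
    rcases k with _ | _ | i <;> rfl
  have eo : haltList p.machine (p.output w.length) =
      ⟨none, false, contents (Function.update ρ 0 0) (p.output w.length ++ [])⟩ := by
    refine congrArg (TM2.Cfg.mk _ _) (funext fun k => ?_)
    rw [hρ, Function.update_idem, List.append_nil]
    rcases k with _ | _ | i
    · rfl
    · rfl
    · have : Function.update (fun _ => 0) 0 0 = fun _ : ℕ => 0 := Function.update_eq_self ..
      rw [this]
      rfl
  rw [ei, eo]
  exact h

/-- A function of the length of the input that is the output of a loop program is computable in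
polynomial time. -/
theorem computableInPolyTime [Fintype T] {α β : Type} {ea : α → List Bool} {eb : β → List T}
    {f : α → β} (p : LoopProg T) (hp : p.depth ≤ 2)
    (h : ∀ a, p.output (ea a).length = eb (f a)) :
    Nonempty (TM2ComputableInPolyTime ea eb f) := by
  refine ⟨{ tm := p.machine
            inputAlphabet := Equiv.refl Bool
            outputAlphabet := Equiv.refl T
            time := (.X + 1) + p.costPoly + (.X + 1)
            outputsFun := fun a => ?_ }⟩
  have hr := p.machine_outputs hp (ea a)
  have hk := hr.choose_spec
  refine ⟨⟨hr.choose, ?_⟩, ?_⟩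
  · have e1 : (ea a).map (Equiv.refl Bool).invFun = ea a := List.map_id _
    have e2 : (eb (f a)).map (Equiv.refl T).invFun = p.output (ea a).length :=
      (List.map_id _).trans (h a).symm
    refine Eq.trans ?_ (hk.2.trans ?_)
    · exact congrArg (fun w => (flip bind (TM2.step p.mainCode))^[hr.choose]
        (some (initList p.machine w))) e1
    · exact congrArg (fun w => some (haltList p.machine w)) e2.symm
  · simp only [Polynomial.eval_add, Polynomial.eval_X, Polynomial.eval_one, eval_costPoly]
    exact hk.1

end LoopProg

/-! ### Printing the description of the local map of an automaton -/

namespace LoopProg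

variable {T : Type}

/-- Executing programs one after the other. -/
def seqs (l : List (LoopProg T)) : LoopProg T := l.foldr seq (emit [])

theorem output_seqs (l : List (LoopProg T)) (m : ℕ) :
    (seqs l).output m = l.flatMap fun p => p.output m := by
  induction l with
  | nil => rfl
  | cons p l ih => rw [seqs, List.foldr_cons, output, ← seqs, ih, List.flatMap_cons]

theorem depth_seqs {l : List (LoopProg T)} {k : ℕ} (h : ∀ p ∈ l, p.depth ≤ k) :
    (seqs l).depth ≤ k := by
  induction l with
  | nil => exact Nat.zero_le _
  | cons p l ih =>
    exact max_le (h p List.mem_cons_self) (ih fun q hq => h q (List.mem_cons_of_mem _ hq))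

/-- Printing the letter `t` as many times as the value of `α * m + β`, for the counter `m`. -/
def ticks (t : T) (α β : ℕ) : LoopProg T :=
  seq (loop (emit (List.replicate α t))) (emit (List.replicate β t))

theorem output_ticks (t : T) (α β m : ℕ) :
    (ticks t α β).output m = List.replicate (α * m + β) t := by
  have h : (List.range m).flatMap (fun _ => List.replicate α t) = List.replicate (α * m) t := by
    induction m with
    | zero => rfl
    | succ m ih => rw [List.range_succ, List.flatMap_append, ih, List.flatMap_singleton,
        ← List.replicate_add, Nat.mul_succ]
  rw [ticks, output, output, output, List.replicate_add, ← h]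
  rfl

end LoopProg

namespace BlockCode

open LoopProg LocalMap

variable {A : Type} (B : BlockCode A)

/-- Printing the positions of the block with the number `e.1 * m + e.2`. -/
def posProg (e : ℕ × ℕ) : LoopProg Token :=
  seqs ((List.range B.width).map fun w =>
    .seq (ticks .tick (e.1 * B.width) (e.2 * B.width + w)) (.emit [.sep]))

theorem output_posProg (e : ℕ × ℕ) (m : ℕ) :
    (B.posProg e).output m = (B.blockPos (e.1 * m + e.2)).flatMap fun p =>
      List.replicate p Token.tick ++ [Token.sep] := by
  rw [posProg, output_seqs, blockPos, List.flatMap_map, List.flatMap_map]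
  congr 1
  funext w
  rw [output, output_ticks, output]
  congr 2
  ring

/-- Printing a rule, for cells that depend on the counter. -/
def ruleProg (cells : List (ℕ × ℕ)) (F : List A → Bool) : LoopProg Token :=
  .seq (seqs (cells.map B.posProg))
    (.emit (ruleWord ⟨[], (B.rule (cells.map fun _ => 0) F).table⟩))

/-- A truth table does not mention positions, so `ruleProg` can emit it as a fixed word inside a
loop. -/
theorem table_rule_congr {c d : List ℕ} (h : c.length = d.length) (F : List A → Bool) :
    (B.rule c F).table = (B.rule d F).table := by
  simp only [rule, BitRule.ofFun, length_flatMap_blockPos, h]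

theorem output_ruleProg (cells : List (ℕ × ℕ)) (F : List A → Bool) (m : ℕ) :
    (B.ruleProg cells F).output m =
      ruleWord (B.rule (cells.map fun e => e.1 * m + e.2) F) := by
  rw [ruleProg, output, output_seqs, output, ruleWord, ruleWord, List.flatMap_nil, List.nil_append,
    B.table_rule_congr (d := cells.map fun e => e.1 * m + e.2) (by simp)]
  congr 1
  simp only [rule, BitRule.ofFun]
  rw [List.flatMap_map, List.flatMap_assoc, List.flatMap_map]
  congr 1
  funext e
  exact B.output_posProg e m

theorem depth_ruleProg (cells : List (ℕ × ℕ)) (F : List A → Bool) :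
    (B.ruleProg cells F).depth ≤ 1 := by
  refine max_le (depth_seqs fun p hp => ?_) (Nat.zero_le _)
  obtain ⟨e, -, rfl⟩ := List.mem_map.1 hp
  refine depth_seqs fun p hp => ?_
  obtain ⟨w, -, rfl⟩ := List.mem_map.1 hp
  simp [ticks, depth]

/-- Printing the rules for a block. -/
def rulesProg (cells : List (ℕ × ℕ)) (F : List A → A) : LoopProg Token :=
  seqs ((List.range B.width).map fun w =>
    B.ruleProg cells fun l => (B.enc (F l)).getD w false)

theorem output_rulesProg (cells : List (ℕ × ℕ)) (F : List A → A) (m : ℕ) :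
    (B.rulesProg cells F).output m =
      (B.rules (cells.map fun e => e.1 * m + e.2) F).flatMap ruleWord := by
  rw [rulesProg, output_seqs, rules, List.flatMap_map, List.flatMap_map]
  congr 1
  funext w
  exact B.output_ruleProg cells _ m

theorem depth_rulesProg (cells : List (ℕ × ℕ)) (F : List A → A) :
    (B.rulesProg cells F).depth ≤ 1 := by
  refine depth_seqs fun p hp => ?_
  obtain ⟨w, -, rfl⟩ := List.mem_map.1 hp
  exact B.depth_ruleProg _ _

end BlockCode

namespace Automaton

open LoopProg LocalMap

variable {A : Type} (U : Automaton A) (B : BlockCode A) (a : ℕ)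

/-- Printing the rules for `a` consecutive cells. -/
def midProg (s : Bool) : LoopProg Token :=
  seqs ((List.range a).map fun e =>
    B.rulesProg [(0, 0), (a, e), (a, e + 1), (a, e + 2)] (U.midFun B s))

theorem output_midProg (s : Bool) (m : ℕ) :
    (U.midProg B a s).output m = (U.midRules B a s m).flatMap ruleWord := by
  rw [midProg, output_seqs, midRules, List.flatMap_assoc, List.flatMap_map]
  congr 1
  funext e
  rw [B.output_rulesProg]
  simp

theorem depth_midProg (s : Bool) : (U.midProg B a s).depth ≤ 1 := by
  refine depth_seqs fun p hp => ?_
  obtain ⟨w, -, rfl⟩ := List.mem_map.1 hp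
  exact B.depth_rulesProg _ _

/-- Printing the rules for a successor. -/
def succProg (s : Bool) : LoopProg Token :=
  -- The loop covers the groups with numbers below `L`; the copy after it runs with the counter at
  -- `L` and prints the last group.
  seqs [B.rulesProg [(0, 0), (0, 1)] (U.firstFun B s), .loop (U.midProg B a s), U.midProg B a s,
    B.rulesProg [(0, 0), (a, a), (a, a + 1)] (U.lastFun B s)]

theorem output_succProg (s : Bool) (L : ℕ) :
    (U.succProg B a s).output L = (U.succRules B a L s).flatMap ruleWord := by
  have h : (loop (U.midProg B a s)).output L =
      (List.range L).flatMap fun i => (U.midRules B a s i).flatMap ruleWord := by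
    rw [output]
    congr 1
    funext i
    exact U.output_midProg B a s i
  rw [succProg, output_seqs, succRules, List.range_succ]
  simp only [List.flatMap_cons, List.flatMap_nil, List.flatMap_append, h, output_midProg,
    B.output_rulesProg, List.flatMap_assoc]
  simp

theorem depth_succProg (s : Bool) : (U.succProg B a s).depth ≤ 2 := by
  refine depth_seqs fun p hp => ?_
  have h := U.depth_midProg B a s
  simp only [List.mem_cons, List.not_mem_nil, or_false] at hp
  rcases hp with rfl | rfl | rfl | rfl
  · exact (B.depth_rulesProg _ _).trans (by omega)
  · exact Nat.succ_le_succ h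
  · omega
  · exact (B.depth_rulesProg _ _).trans (by omega)

/-- Printing the description of the local map. -/
def localMapProg : LoopProg Token :=
  seqs [ticks .tick (a * B.width) ((a + 2) * B.width),
    .emit (Token.sep :: Token.close :: (U.kindRules B).flatMap ruleWord),
    .loop (B.ruleProg [(1, 0)] fun l => U.idx (l.headD (B.dec []))),
    U.succProg B a false, U.succProg B a true]

theorem output_localMapProg (L : ℕ) :
    (U.localMapProg B a).output L = (U.localMap B a L).word := by
  have h : (loop (B.ruleProg [(1, 0)] fun l => U.idx (l.headD (B.dec [])))).output L =
      (U.idxRules B L).flatMap ruleWord := by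
    rw [output, idxRules, List.flatMap_map]
    congr 1
    funext i
    rw [B.output_ruleProg]
    simp
  have e : a * B.width * L + (a + 2) * B.width = (a * L + a + 2) * B.width := by ring
  rw [localMapProg, output_seqs, LocalMap.word, localMap]
  simp only [List.flatMap_cons, List.flatMap_nil, List.flatMap_append, h, output_ticks,
    output_succProg, e]
  simp [ruleWord, output]

theorem depth_localMapProg : (U.localMapProg B a).depth ≤ 2 := by
  refine depth_seqs fun p hp => ?_
  simp only [List.mem_cons, List.not_mem_nil, or_false] at hp
  rcases hp with rfl | rfl | rfl | rfl | rfl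
  · simp [ticks, depth]
  · exact Nat.zero_le _
  · exact Nat.succ_le_succ (B.depth_ruleProg _ _)
  · exact U.depth_succProg B a _
  · exact U.depth_succProg B a _

/-- A machine prints the local map in time polynomial in the length of the input. -/
theorem computableInPolyTime_localMap :
    Nonempty (Turing.TM2ComputableInPolyTime Nat.bits LocalMap.word
      fun n => U.localMap B a n.size) :=
  (U.localMapProg B a).computableInPolyTime (U.depth_localMapProg B a) fun n => by
    rw [output_localMapProg, Nat.size_eq_bits_len]

end Automaton

/-! ### Functions computed by stack machines -/

theorem two_pow_log_le (c n : ℕ) :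
    2 ^ (c * (Nat.log 2 n + 1)) ≤ n ^ (2 * c) + 4 ^ c := by
  rcases le_or_gt n 1 with h | h
  · have : Nat.log 2 n = 0 := Nat.log_of_lt (by omega)
    rw [this, zero_add, mul_one]
    exact (Nat.pow_le_pow_left (by norm_num) c).trans (Nat.le_add_left _ _)
  · have h1 : 2 ^ (Nat.log 2 n + 1) ≤ n ^ 2 := by
      rw [pow_succ, sq]
      exact Nat.mul_le_mul (Nat.pow_log_le_self 2 (by omega)) h
    calc 2 ^ (c * (Nat.log 2 n + 1)) = (2 ^ (Nat.log 2 n + 1)) ^ c := by rw [mul_comm, pow_mul]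
      _ ≤ (n ^ 2) ^ c := Nat.pow_le_pow_left h1 c
      _ = n ^ (2 * c) := (pow_mul _ _ _).symm
      _ ≤ _ := Nat.le_add_right _ _

theorem two_pow_log_le_pow_add (c n : ℕ) :
    2 ^ (c * (Nat.log 2 n + 1)) ≤ n ^ (2 * c + 4 ^ c) + (2 * c + 4 ^ c) := by
  rcases n.eq_zero_or_pos with rfl | h
  · have := Nat.pow_le_pow_left (show 2 ≤ 4 by norm_num) c
    rw [Nat.log_zero_right, zero_add, mul_one]
    exact this.trans ((Nat.le_add_left _ _).trans (Nat.le_add_left _ _))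
  · have := Nat.pow_le_pow_right h (Nat.le_add_right (2 * c) (4 ^ c))
    have := two_pow_log_le c n
    omega

theorem natSize_le_log (n : ℕ) : n.size ≤ Nat.log 2 n + 1 :=
  Nat.size_le.2 (Nat.lt_pow_succ_log_self (by norm_num) n)

/-- If the values of a function are the values of configurations of a stack machine, whose
stacks have logarithmic height, then the function is computed by locally uniform circuits. -/
theorem StackMachine.exists_local_uniform {Q ι Γ : Type} [Finite Q] [Finite ι] [Finite Γ]
    (M : StackMachine Q ι Γ) {a : ℕ} (ha : 1 ≤ a) (c₀ : ℕ → M.Cfg) (f : List Bool → Bool)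
    (h : ∀ n, ∀ x : List Bool, x.length = n →
      M.Evaluates (a * n.size + a + 2) n.size x (c₀ n) (f x)) :
    ∃ C : (n : ℕ) → Circuit n, PolySize C ∧ Computes C f ∧
      ∃ D : ℕ → LocalMap,
        Nonempty (Turing.TM2ComputableInPolyTime Nat.bits LocalMap.word D) ∧
        ∃ c k : ℕ, ∀ n,
          (D n).inLen = (C n).len ∧ (C n).len ≤ c * (Nat.log 2 n + 1) ∧
          (D n).out.length = 3 + Nat.size n + 2 * (C n).len ∧
          (D n).HasLocality k ∧
          (∀ g ∈ (C n).gates, (D n).gateAt n g = (C n).gate g) ∧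
          ∀ g : List Bool, ¬ Relation.TransGen
            (fun a b => a.length = (C n).len ∧ b ∈ ((D n).gateAt n a).children) g g := by
  -- Heights, indices and children do not depend on the values of the input bits, so any word of
  -- length `n` witnesses validity.
  have hv : ∀ n, M.Valid (a * n.size + a + 2) n.size n (c₀ n) := fun n =>
    ⟨_, h n (List.replicate n false) List.length_replicate⟩
  have : Nonempty (Cell Q ι Γ) := ⟨M.cell (c₀ 0) 0⟩
  obtain ⟨B⟩ := BlockCode.nonempty (Cell Q ι Γ × ClockCell (Nat.card (Cell Q ι Γ)))
  have hlen : ∀ n : ℕ, (a * n.size + a + 2) * B.width ≤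
      ((2 * a + 2) * B.width) * (Nat.log 2 n + 1) := by
    intro n
    have h1 := Nat.mul_le_mul_left a (natSize_le_log n)
    calc _ ≤ (a * (Nat.log 2 n + 1) + a + 2) * B.width := Nat.mul_le_mul_right _ (by omega)
      _ ≤ ((2 * a + 2) * (Nat.log 2 n + 1)) * B.width := Nat.mul_le_mul_right _ (by nlinarith)
      _ = _ := by ring
  refine ⟨fun n => M.circuit B ha (hv n),
    ⟨2 * ((2 * a + 2) * B.width) + 4 ^ ((2 * a + 2) * B.width), fun n => ?_⟩, fun n x hx => ?_,
    fun n => M.gateMap B a n, (M.automaton.clocked _).computableInPolyTime_localMap B a,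
    (2 * a + 2) * B.width, 4 * B.width, fun n => ⟨rfl, hlen n, ?_, ?_, fun _ _ => rfl, ?_⟩⟩
  · exact (M.card_circuit_le B ha (hv n)).trans
      ((Nat.pow_le_pow_right (by norm_num) (hlen n)).trans (two_pow_log_le_pow_add _ n))
  · exact M.circuit_val B ha (hv n) hx (h n x hx) 0 (M.circuit B ha (hv n)).out_mem
  · exact (M.automaton.clocked _).length_localMap_out B a n.size
  · exact (M.automaton.clocked _).hasLocality_localMap B a n.size ha
  · exact fun g hg => (M.automaton.transGen_time (P := fun g => g.length = _) B hg).false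

/-! ### Chains of copy gates -/

namespace StackMachine

variable {Q ι Γ : Type} (M : StackMachine Q ι Γ)

/-- The second configuration is reached from the first through copy gates. -/
def Chain (H : ℕ) : M.Cfg → M.Cfg → Prop :=
  Relation.ReflTransGen fun c d =>
    M.kind c.1 = .copy ∧ (∀ i, (c.2 i).length ≤ H) ∧ d = M.succ false c

variable {M} in
theorem Chain.evaluates {H L : ℕ} {x : List Bool} {c d : M.Cfg} {b : Bool} (h : M.Chain H c d)
    (hd : M.Evaluates H L x d b) : M.Evaluates H L x c b := by
  induction h using Relation.ReflTransGen.head_induction_on with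
  | refl => exact hd
  | @head c e h _ ih =>
    obtain ⟨hk, hh, rfl⟩ := h
    have := Evaluates.intro (M := M) (S := H) (L := L) (x := x) c (fun _ => b) hh
      (fun hi => by rw [hk] at hi; cases hi) (fun s hs => by
        rw [hk, sides, List.mem_singleton] at hs
        subst hs
        exact ih)
    rwa [hk] at this

end StackMachine

theorem bitsVal_bits (n : ℕ) : bitsVal n.bits = n := by
  have h : n.bits.map Bool.toNat = Nat.digits 2 n := by
    rw [Nat.digits_two_eq_bits]
    exact List.map_congr_left fun b _ => by cases b <;> rfl
  rw [bitsVal, h, Nat.ofDigits_digits]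

namespace Kind

/-- The type that is encoded by three bits. -/
def ofBits : Bool → Bool → Bool → Kind
  | false, false, false => and
  | false, false, true => or
  | false, true, false => not
  | false, true, true => copy
  | true, false, _ => input
  | true, true, b => const b

end Kind

namespace Gate

/-- The type of a gate, without the index of the variable. -/
def kind : Gate → Kind
  | and _ _ => .and
  | or _ _ => .or
  | not _ => .not
  | copy _ => .copy
  | input _ => .input
  | const b => .const b

end Gate

/-! ### A stack machine that explores a uniform family of circuits -/

namespace Explorer

open Turing TM2

variable (M : TM2ComputableAux (Option Bool) (Option Bool))

/-- The statements of the uniformity machine. -/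
abbrev MStmt := TM2.Stmt M.tm.Γ M.tm.Λ M.tm.σ

/-- The statements that occur in the program of the uniformity machine. -/
def stmts : Set (MStmt M) := {q | ∃ l, q ∈ stmts₁ (M.tm.m l)}

/-- `FinTM2` requires only the alphabet of the input stack to be finite. Every other symbol comes
from a push statement executed in some internal state; finiteness of the set of statements therefore
makes `Sym` a finite alphabet. -/
theorem finite_stmts : (stmts M).Finite := by
  have := M.tm.ΛFin
  have h : stmts M = ⋃ l, (stmts₁ (M.tm.m l) : Set (MStmt M)) := by
    ext q
    simp [stmts]
  rw [h]
  exact Set.finite_iUnion fun l => Finset.finite_toSet _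

theorem mem_stmts (l : M.tm.Λ) : M.tm.m l ∈ stmts M := ⟨l, stmts₁_self⟩

variable {M} in
theorem mem_stmts_of_mem {q r : MStmt M} (hq : q ∈ stmts M) (hr : r ∈ stmts₁ q) :
    r ∈ stmts M := by
  obtain ⟨l, h⟩ := hq
  exact ⟨l, stmts₁_trans h hr⟩

/-- The statements that occur in the program, as a type. -/
abbrev Prog := {q : MStmt M // q ∈ stmts M}

open Classical in
/-- The statement, if it occurs in the program. -/
noncomputable def toProg (q : MStmt M) : Prog M :=
  if h : q ∈ stmts M then ⟨q, h⟩ else ⟨M.tm.m M.tm.main, mem_stmts M _⟩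

variable {M} in
theorem toProg_coe {q : MStmt M} (h : q ∈ stmts M) : toProg M q = ⟨q, h⟩ := dif_pos h

/-- The symbols on the stacks.  A symbol of the uniformity machine is represented by the push
statement from which it originates and the state in which it was executed. -/
abbrev Sym := (Prog M × M.tm.σ) ⊕ M.tm.Γ M.tm.k₀ ⊕ Option Bool

/-- The additional stacks: for the binary representation of the number of variables, and the
input, the output and intermediate results of queries to the uniformity machine. -/
inductive Extra where
  | orig
  | inp
  | out
  | tmp
  deriving DecidableEq

instance : Finite Extra :=
  Finite.of_surjective (fun x : Bool × Bool => bif x.1 then bif x.2 then Extra.orig else .inp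
    else bif x.2 then .out else .tmp) fun e => by
    cases e with
    | orig => exact ⟨(true, true), rfl⟩
    | inp => exact ⟨(true, false), rfl⟩
    | out => exact ⟨(false, true), rfl⟩
    | tmp => exact ⟨(false, false), rfl⟩

/-- The states of the stack machine. -/
inductive Ctl (P σ : Type) where
  | sim (q : P) (v : σ) (s : Bool)
  | skip (two : Bool)
  | ty0
  | ty1 (b : Bool)
  | ty2 (b b' : Bool)
  | sep (κ : Kind)
  | move (κ : Kind)
  | back (κ : Kind)
  | node (κ : Kind)

instance (P σ : Type) [Finite P] [Finite σ] : Finite (Ctl P σ) := by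
  let F : (P × σ × Bool) ⊕ Bool ⊕ Unit ⊕ Bool ⊕ (Bool × Bool) ⊕ Kind ⊕ Kind ⊕ Kind ⊕ Kind →
      Ctl P σ :=
    Sum.elim (fun x => .sim x.1 x.2.1 x.2.2) <| Sum.elim .skip <| Sum.elim (fun _ => .ty0) <|
      Sum.elim .ty1 <| Sum.elim (fun x => .ty2 x.1 x.2) <| Sum.elim .sep <| Sum.elim .move <|
        Sum.elim .back .node
  refine Finite.of_surjective F fun c => ?_
  cases c with
  | sim q v s => exact ⟨.inl (q, v, s), rfl⟩
  | skip b => exact ⟨.inr (.inl b), rfl⟩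
  | ty0 => exact ⟨.inr (.inr (.inl ())), rfl⟩
  | ty1 b => exact ⟨.inr (.inr (.inr (.inl b))), rfl⟩
  | ty2 b b' => exact ⟨.inr (.inr (.inr (.inr (.inl (b, b'))))), rfl⟩
  | sep κ => exact ⟨.inr (.inr (.inr (.inr (.inr (.inl κ))))), rfl⟩
  | move κ => exact ⟨.inr (.inr (.inr (.inr (.inr (.inr (.inl κ)))))), rfl⟩
  | back κ => exact ⟨.inr (.inr (.inr (.inr (.inr (.inr (.inr (.inl κ))))))), rfl⟩
  | node κ => exact ⟨.inr (.inr (.inr (.inr (.inr (.inr (.inr (.inr κ))))))), rfl⟩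

/-- The symbol that a statement pushes on the stack `k`. -/
def pushed (k : M.tm.K) : MStmt M → M.tm.σ → Option (M.tm.Γ k)
  | .push k' f _, v => if h : k' = k then some (h ▸ f v) else none
  | _, _ => none

/-- The symbol on the stack `k` of the uniformity machine that is represented. -/
def value (k : M.tm.K) : Sym M → Option (M.tm.Γ k)
  | .inl (q, v) => pushed M k q.1 v
  | .inr (.inl a) => if h : M.tm.k₀ = k then some (h ▸ a) else none
  | .inr (.inr _) => none

/-- A letter on one of the additional stacks. -/
def letter (b : Option Bool) : Sym M := .inr (.inr b)

/-- The letter that is represented. -/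
def toLetter : Sym M → Option Bool
  | .inr (.inr b) => b
  | _ => none

/-- The input symbol that corresponds to a letter. -/
def toInput (a : Sym M) : Sym M := .inr (.inl (M.inputAlphabet.symm (toLetter M a)))

/-- The letter that corresponds to an output symbol. -/
def toOutput (a : Sym M) : Sym M := letter M ((value M M.tm.k₁ a).bind M.outputAlphabet)

/-- The names of the stacks. -/
abbrev Stack := M.tm.K ⊕ Extra

/-- A change of one stack. -/
def only (i : Stack M) (op : StackOp (Stack M) (Sym M)) : Stack M → StackOp (Stack M) (Sym M) :=
  Function.update (fun _ => .keep) i op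

/-- The action on the additional stacks. -/
def extraOps (inp out tmp : StackOp (Stack M) (Sym M)) :
    Stack M → StackOp (Stack M) (Sym M)
  | .inl _ => .keep
  | .inr .orig => .keep
  | .inr .inp => inp
  | .inr .out => out
  | .inr .tmp => tmp

/-- The simulation of a statement. -/
noncomputable def simulate (q : Prog M) (v : M.tm.σ) (s : Bool)
    (top : Stack M → Option (Sym M)) :
    Ctl (Prog M) M.tm.σ × (Stack M → StackOp (Stack M) (Sym M)) :=
  match q.1 with
  | .push k _ r => (.sim (toProg M r) v s, only M (.inl k) (.push (.inl (q, v))))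
  | .peek k f r => (.sim (toProg M r) (f v ((top (.inl k)).bind (value M k))) s, fun _ => .keep)
  | .pop k f r => (.sim (toProg M r) (f v ((top (.inl k)).bind (value M k))) s,
      only M (.inl k) .pop)
  | .load f r => (.sim (toProg M r) (f v) s, fun _ => .keep)
  | .branch f r₁ r₂ => (.sim (toProg M (bif f v then r₁ else r₂)) v s, fun _ => .keep)
  | .goto f => (.sim (toProg M (M.tm.m (f v))) v s, fun _ => .keep)
  -- All operations of a step read the old stacks, so the output can be copied while its stack is
  -- cleared. For the second child, the entry of the first must be skipped.
  | .halt => (if s then .skip true else .ty0, fun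
    | .inl _ => .clear
    | .inr .out => .copy (.inl M.tm.k₁) (toOutput M)
    | .inr _ => .keep)

/-- The start of the simulation. -/
noncomputable def startOps : Stack M → StackOp (Stack M) (Sym M)
  | .inl k => if k = M.tm.k₀ then .copy (.inr .inp) (toInput M) else .keep
  | .inr .inp => .clear
  | .inr _ => .keep

/-- The action of the stack machine. -/
noncomputable def act (s : Bool) (c : Ctl (Prog M) M.tm.σ) (top : Stack M → Option (Sym M)) :
    Ctl (Prog M) M.tm.σ × (Stack M → StackOp (Stack M) (Sym M)) :=
  let x := (top (.inr .out)).bind (toLetter M)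
  match c with
  | .sim q v s => simulate M q v s top
  -- An entry contains two separators; the flag says whether both are still ahead.
  | .skip two => (if x.isSome then .skip two else if two then .skip false else .ty0,
      extraOps M .keep .pop .keep)
  | .ty0 => (.ty1 (x.getD false), extraOps M .keep .pop .keep)
  | .ty1 b => (.ty2 b (x.getD false), extraOps M .keep .pop .keep)
  | .ty2 b b' =>
    let κ := Kind.ofBits b b' (x.getD false)
    -- For an input gate the index follows at once and is moved in place of a label. Otherwise a
    -- separator follows, and `sep` puts `n` on the input stack, beneath the label of the next
    -- query.
    (if κ = .input then .move κ else .sep κ, extraOps M .keep .pop .keep)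
  | .sep κ => (.move κ, extraOps M (.copy (.inr .orig) id) .pop .keep)
  | .move κ =>
    match x with
    | some b => (.move κ, extraOps M .keep .pop (.push (letter M (some b))))
    | none => (.back κ, fun _ => .keep)
  | .back κ =>
    match top (.inr .tmp) with
    | some a => (.back κ, extraOps M (.push a) .keep .pop)
    | none => (.node κ, extraOps M .keep .clear .keep)
  | .node _ => (.sim (toProg M (M.tm.m M.tm.main)) M.tm.initialState s, startOps M)

/-- The stack machine that explores the circuits. -/
noncomputable def explorer : StackMachine (Ctl (Prog M) M.tm.σ) (Stack M) (Sym M) where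
  act := act M
  kind
    | .node κ => κ
    | _ => .copy
  idxStack := .inr .inp
  idxBit a := (toLetter M a).getD false

/-- The contents of all stacks. -/
def contents (S : M.tm.K → List (Sym M)) (n i o t : List (Option Bool)) :
    Stack M → List (Sym M)
  | .inl k => S k
  | .inr .orig => n.map (letter M)
  | .inr .inp => i.map (letter M)
  | .inr .out => o.map (letter M)
  | .inr .tmp => t.map (letter M)

/-! ### Reading the answer to a query -/

variable {M}

theorem chain_single {H : ℕ} {q q' : Ctl (Prog M) M.tm.σ} {S S' : M.tm.K → List (Sym M)}
    {n i o t n' i' o' t' : List (Option Bool)} (hk : (explorer M).kind q = .copy)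
    (hS : ∀ k, (S k).length ≤ H) (hn : n.length ≤ H) (hi : i.length ≤ H) (ho : o.length ≤ H)
    (ht : t.length ≤ H)
    (h : (explorer M).succ false (q, contents M S n i o t) = (q', contents M S' n' i' o' t')) :
    (explorer M).Chain H (q, contents M S n i o t) (q', contents M S' n' i' o' t') := by
  refine .single ⟨hk, fun j => ?_, h.symm⟩
  rcases j with k | _ | _ | _ | _
  · exact hS k
  all_goals simpa [contents]

theorem apply_extraOps (S : M.tm.K → List (Sym M)) (n i o t : List (Option Bool))
    {inp out tmp : StackOp (Stack M) (Sym M)} {i' o' t' : List (Option Bool)}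
    (hi : inp.apply (contents M S n i o t) (.inr .inp) = i'.map (letter M))
    (ho : out.apply (contents M S n i o t) (.inr .out) = o'.map (letter M))
    (ht : tmp.apply (contents M S n i o t) (.inr .tmp) = t'.map (letter M)) :
    (fun j => (extraOps M inp out tmp j).apply (contents M S n i o t) j) =
      contents M S n i' o' t' := by
  funext j
  rcases j with k | _ | _ | _ | _
  · rfl
  · rfl
  · exact hi
  · exact ho
  · exact ht

variable {H : ℕ} {S : M.tm.K → List (Sym M)} {n i o t : List (Option Bool)}

theorem chain_skip (hS : ∀ k, (S k).length ≤ H) (hn : n.length ≤ H) (hi : i.length ≤ H)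
    (ht : t.length ≤ H) (w : List Bool) (ho : (w.map some ++ none :: o).length ≤ H) (two : Bool) :
    (explorer M).Chain H (.skip two, contents M S n i (w.map some ++ none :: o) t)
      (if two then .skip false else .ty0, contents M S n i o t) := by
  induction w with
  | nil =>
    refine chain_single rfl hS hn hi ho ht ?_
    exact congrArg (Prod.mk _) (apply_extraOps S n i _ t rfl rfl rfl)
  | cons b w ih =>
    refine Relation.ReflTransGen.trans (chain_single rfl hS hn hi ho ht ?_)
      (ih (Nat.le_of_succ_le ho))
    exact congrArg (Prod.mk _) (apply_extraOps S n i _ t rfl rfl rfl)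

theorem chain_move (hS : ∀ k, (S k).length ≤ H) (hn : n.length ≤ H) (hi : i.length ≤ H)
    (w : List Bool) (ho : (w.map some ++ none :: o).length ≤ H) (t : List Bool)
    (ht : w.length + t.length ≤ H) (κ : Kind) :
    (explorer M).Chain H (.move κ, contents M S n i (w.map some ++ none :: o) (t.map some))
      (.back κ, contents M S n i (none :: o) ((w.reverse ++ t).map some)) := by
  induction w generalizing t with
  | nil => exact chain_single rfl hS hn hi ho (by simpa using ht) rfl
  | cons b w ih =>
    rw [List.length_cons] at ht
    have h := ih (Nat.le_of_succ_le ho) (b :: t) (by rw [List.length_cons]; omega)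
    rw [List.reverse_cons, List.append_assoc]
    refine Relation.ReflTransGen.trans (chain_single rfl hS hn hi ho
      (by rw [List.length_map]; omega) ?_) h
    exact congrArg (Prod.mk _) (apply_extraOps S n i _ _ rfl rfl rfl)

/-- Moving a word from stack to stack reverses it; this second reversal undoes that of `chain_move`.
-/
theorem chain_back (hS : ∀ k, (S k).length ≤ H) (hn : n.length ≤ H) (ho : o.length ≤ H)
    (t i : List (Option Bool)) (ht : t.length + i.length ≤ H) (κ : Kind) :
    (explorer M).Chain H (.back κ, contents M S n i o t)
      (.node κ, contents M S n (t.reverse ++ i) [] []) := by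
  induction t generalizing i with
  | nil =>
    refine chain_single rfl hS hn (by simpa using ht) ho (Nat.zero_le _) ?_
    exact congrArg (Prod.mk _) (apply_extraOps S n i _ _ rfl rfl rfl)
  | cons b t ih =>
    rw [List.length_cons] at ht
    have h := ih (b :: i) (by rw [List.length_cons]; omega)
    rw [List.reverse_cons, List.append_assoc]
    refine Relation.ReflTransGen.trans (chain_single rfl hS hn (by omega) ho
      (by rw [List.length_cons]; omega) ?_) h
    exact congrArg (Prod.mk _) (apply_extraOps S n i _ _ rfl rfl rfl)

/-- The word that describes the type and the label of a gate. -/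
def entry (G : Gate) (c : List Bool) : List (Option Bool) :=
  G.typeWord.map some ++ none :: (c.map some ++ [none])

/-- The word on the input stack when the gate with the given label is visited. -/
def gateWord (G : Gate) (c : List Bool) (n : List (Option Bool)) : List (Option Bool) :=
  match G with
  | .input i => i.bits.map some
  | _ => c.map some ++ n

theorem chain_type (hS : ∀ k, (S k).length ≤ H) (hn : n.length ≤ H) (b₀ b₁ b₂ : Bool)
    (ho : (some b₀ :: some b₁ :: some b₂ :: o).length ≤ H) :
    (explorer M).Chain H (.ty0, contents M S n [] (some b₀ :: some b₁ :: some b₂ :: o) [])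
      (if Kind.ofBits b₀ b₁ b₂ = .input then .move (Kind.ofBits b₀ b₁ b₂)
        else .sep (Kind.ofBits b₀ b₁ b₂), contents M S n [] o []) := by
  have z : ([] : List (Option Bool)).length ≤ H := Nat.zero_le _
  refine .trans (b := (.ty1 b₀, contents M S n [] (some b₁ :: some b₂ :: o) [])) ?_
    (.trans (b := (.ty2 b₀ b₁, contents M S n [] (some b₂ :: o) [])) ?_ ?_)
  · refine chain_single rfl hS hn z ho z ?_
    exact congrArg (Prod.mk _) (apply_extraOps S n [] _ _ rfl rfl rfl)
  · refine chain_single rfl hS hn z (Nat.le_of_succ_le ho) z ?_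
    exact congrArg (Prod.mk _) (apply_extraOps S n [] _ _ rfl rfl rfl)
  · refine chain_single rfl hS hn z (Nat.le_of_succ_le (Nat.le_of_succ_le ho)) z ?_
    exact congrArg (Prod.mk _) (apply_extraOps S n [] _ _ rfl rfl rfl)

theorem chain_label (hS : ∀ k, (S k).length ≤ H) (c : List Bool)
    (ho : (none :: (c.map some ++ none :: o)).length ≤ H) (hc : (c.map some ++ n).length ≤ H)
    (κ : Kind) :
    (explorer M).Chain H (.sep κ, contents M S n [] (none :: (c.map some ++ none :: o)) [])
      (.node κ, contents M S n (c.map some ++ n) [] []) := by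
  have z : ([] : List (Option Bool)).length ≤ H := Nat.zero_le _
  simp only [List.length_append, List.length_map, List.length_cons] at ho hc
  have hn : n.length ≤ H := by omega
  refine .trans (b := (.move κ,
    contents M S n n (c.map some ++ none :: o) (([] : List Bool).map some))) ?_ ?_
  · refine chain_single rfl hS hn z (by simp; omega) z ?_
    exact congrArg (Prod.mk _) (apply_extraOps S n [] _ _ (List.map_id _) rfl rfl)
  · refine .trans (chain_move hS hn hn c (by simp; omega) [] (by simp; omega) κ) ?_
    have h := chain_back (o := none :: o) hS hn (by simp; omega) ((c.reverse ++ []).map some) n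
      (by simp; omega) κ
    rwa [← List.map_reverse, List.reverse_append, List.reverse_reverse, List.reverse_nil,
      List.nil_append] at h

theorem chain_entry (hS : ∀ k, (S k).length ≤ H) (G : Gate) (c : List Bool)
    (ho : (entry G c ++ o).length ≤ H) (hc : (c.map some ++ n).length ≤ H) :
    (explorer M).Chain H (.ty0, contents M S n [] (entry G c ++ o) [])
      (.node G.kind, contents M S n (gateWord G c n) [] []) := by
  have z : ([] : List (Option Bool)).length ≤ H := Nat.zero_le _
  have hn : n.length ≤ H := by
    rw [List.length_append] at hc
    omega
  rw [entry, List.append_assoc, List.cons_append, List.append_assoc] at ho ⊢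
  have key : ∀ b₀ b₁ b₂, G.typeWord = [b₀, b₁, b₂] → Kind.ofBits b₀ b₁ b₂ = G.kind →
      G.kind ≠ .input → gateWord G c n = c.map some ++ n →
      (explorer M).Chain H (.ty0, contents M S n []
        (G.typeWord.map some ++ none :: (c.map some ++ ([none] ++ o))) [])
        (.node G.kind, contents M S n (gateWord G c n) [] []) := by
    intro b₀ b₁ b₂ hw hb hG hg
    rw [hw] at ho ⊢
    have h := chain_type hS hn b₀ b₁ b₂ ho
    rw [hb, if_neg hG] at h
    rw [hg]
    exact h.trans (chain_label hS c (Nat.le_of_succ_le (Nat.le_of_succ_le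
      (Nat.le_of_succ_le ho))) hc _)
  cases G with
  | and a b => exact key _ _ _ rfl rfl nofun rfl
  | or a b => exact key _ _ _ rfl rfl nofun rfl
  | not a => exact key _ _ _ rfl rfl nofun rfl
  | copy a => exact key _ _ _ rfl rfl nofun rfl
  | const b => exact key _ _ _ rfl (by cases b <;> rfl) nofun rfl
  | input j =>
    rw [Gate.typeWord, List.map_append, List.append_assoc] at ho ⊢
    have h := chain_type (M := M) hS hn true false false ho
    have ho' : (j.bits.map some ++ none :: (c.map some ++ ([none] ++ o))).length ≤ H :=
      Nat.le_of_succ_le (Nat.le_of_succ_le (Nat.le_of_succ_le ho))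
    have hl := ho'
    rw [List.length_append, List.length_map, List.length_cons] at hl
    have h1 := chain_move (M := M) hS hn z j.bits ho' [] (by simp; omega) .input
    have h2 := chain_back (M := M) (o := none :: (c.map some ++ ([none] ++ o))) hS hn
      (by rw [List.length_cons]; omega) ((j.bits.reverse ++ []).map some) []
      (by simp; omega) .input
    rw [← List.map_reverse, List.reverse_append, List.reverse_reverse, List.reverse_nil,
      List.nil_append, List.append_nil (j.bits.map some)] at h2
    exact h.trans (h1.trans h2)

end Explorer

namespace Explorer

open Turing TM2

variable {M : TM2ComputableAux (Option Bool) (Option Bool)}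

/-! ### The simulation of the uniformity machine -/

/-- The largest number of symbols that a statement pushes. -/
def pushes : MStmt M → ℕ
  | .push _ _ r => pushes r + 1
  | .peek _ _ r => pushes r
  | .pop _ _ r => pushes r
  | .load _ r => pushes r
  | .branch _ r₁ r₂ => max (pushes r₁) (pushes r₂)
  | .goto _ => 0
  | .halt => 0

variable (M) in
theorem exists_pushes_le : ∃ P, ∀ l, pushes (M.tm.m l) ≤ P := by
  have := M.tm.ΛFin
  exact ⟨Finset.univ.sup fun l => pushes (M.tm.m l), fun l =>
    Finset.le_sup (f := fun l => pushes (M.tm.m l)) (Finset.mem_univ l)⟩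

/-- The stacks of the uniformity machine are represented. -/
def Represents (R : ∀ k, List (M.tm.Γ k)) (S : M.tm.K → List (Sym M)) : Prop :=
  ∀ k, (S k).map (value M k) = (R k).map some

variable {R : ∀ k, List (M.tm.Γ k)} {S : M.tm.K → List (Sym M)}

theorem Represents.length_eq (h : Represents R S) (k : M.tm.K) :
    (S k).length = (R k).length := by
  simpa using congrArg List.length (h k)

theorem Represents.head (h : Represents R S) (k : M.tm.K) :
    (S k).head?.bind (value M k) = (R k).head? := by
  have := congrArg List.head? (h k)
  rw [List.head?_map, List.head?_map] at this
  cases hS : (S k).head? <;> cases hR : (R k).head? <;> simp_all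

theorem Represents.update (h : Represents R S) {k : M.tm.K} {r : List (M.tm.Γ k)}
    {l : List (Sym M)} (hl : l.map (value M k) = r.map some) :
    Represents (Function.update R k r) (Function.update S k l) := by
  intro j
  by_cases hj : j = k
  · subst hj
    rw [Function.update_self, Function.update_self, hl]
  · rw [Function.update_of_ne hj, Function.update_of_ne hj]
    exact h j

/-- The state that represents the label and the internal state of the uniformity machine. -/
def Matches (s : Bool) : Option M.tm.Λ → M.tm.σ → Ctl (Prog M) M.tm.σ → Prop
  | some l, v, c => c = .sim (toProg M (M.tm.m l)) v s
  | none, v, c => ∃ q : Prog M, q.1 = .halt ∧ c = .sim q v s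

theorem apply_only (k : M.tm.K) (op : StackOp (Stack M) (Sym M)) (S : M.tm.K → List (Sym M))
    (n i o t : List (Option Bool)) :
    (fun j => (only M (.inl k) op j).apply (contents M S n i o t) j) =
      contents M (Function.update S k (op.apply (contents M S n i o t) (.inl k))) n i o t := by
  funext j
  rcases j with j | e
  · by_cases hj : j = k
    · subst hj
      simp [only, contents]
    · have : (Sum.inl j : Stack M) ≠ .inl k := fun h => hj (Sum.inl_injective h)
      rw [only, Function.update_of_ne this, contents, Function.update_of_ne hj]
      rfl
  · rw [only, Function.update_of_ne (by simp)]
    cases e <;> rfl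

variable {H : ℕ} {n i o t : List (Option Bool)}

/-- One step of a `TM2` machine executes a whole statement, whereas the explorer performs one
elementary operation at a time. The summand `pushes q` leaves room for the stacks within the step.
-/
theorem chain_stmt (hn : n.length ≤ H) (hi : i.length ≤ H) (ho : o.length ≤ H)
    (ht : t.length ≤ H) (s : Bool) {q : MStmt M} (hq : q ∈ stmts M) (v : M.tm.σ)
    (hR : Represents R S) (hH : ∀ k, (R k).length + pushes q ≤ H) :
    ∃ S' c, Represents (stepAux q v R).stk S' ∧
      Matches s (stepAux q v R).l (stepAux q v R).var c ∧
      (explorer M).Chain H (.sim ⟨q, hq⟩ v s, contents M S n i o t)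
        (c, contents M S' n i o t) := by
  have hS : ∀ k, (S k).length ≤ H := fun k => by
    have := hH k
    rw [hR.length_eq]
    omega
  induction q generalizing v R S with
  | push k f r ih =>
    have hr : r ∈ stmts M := mem_stmts_of_mem hq (by simp [stmts₁, stmts₁_self])
    have hR' := hR.update (k := k) (r := f v :: R k) (l := .inl (⟨_, hq⟩, v) :: S k) (by
      rw [List.map_cons, List.map_cons, hR k]
      congr 1
      exact dif_pos rfl)
    have hH' : ∀ j, (Function.update R k (f v :: R k) j).length + pushes r ≤ H := by
      intro j
      have := hH j
      rw [pushes] at this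
      by_cases hj : j = k
      · subst hj
        rw [Function.update_self, List.length_cons]
        omega
      · rw [Function.update_of_ne hj]
        omega
    obtain ⟨S', c, h1, h2, h3⟩ := ih hr v hR' hH' fun j => by
      have := hH' j
      rw [hR'.length_eq]
      omega
    refine ⟨S', c, h1, h2, .trans (chain_single rfl hS hn hi ho ht ?_) h3⟩
    rw [← toProg_coe hr]
    exact congrArg (Prod.mk _) (apply_only k _ S n i o t)
  | peek k f r ih =>
    have hr : r ∈ stmts M := mem_stmts_of_mem hq (by simp [stmts₁, stmts₁_self])
    obtain ⟨S', c, h1, h2, h3⟩ := ih hr (f v (R k).head?) hR hH hS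
    refine ⟨S', c, h1, h2, .trans (chain_single rfl hS hn hi ho ht ?_) h3⟩
    rw [← toProg_coe hr, ← hR.head k]
    rfl
  | pop k f r ih =>
    have hr : r ∈ stmts M := mem_stmts_of_mem hq (by simp [stmts₁, stmts₁_self])
    have hR' := hR.update (k := k) (r := (R k).tail) (l := (S k).tail) (by
      rw [List.map_tail, List.map_tail, hR k])
    have hH' : ∀ j, (Function.update R k (R k).tail j).length + pushes r ≤ H := by
      intro j
      have := hH j
      rw [pushes] at this
      by_cases hj : j = k
      · subst hj
        rw [Function.update_self, List.length_tail]
        omega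
      · rw [Function.update_of_ne hj]
        omega
    obtain ⟨S', c, h1, h2, h3⟩ := ih hr (f v (R k).head?) hR' hH' fun j => by
      have := hH' j
      rw [hR'.length_eq]
      omega
    refine ⟨S', c, h1, h2, .trans (chain_single rfl hS hn hi ho ht ?_) h3⟩
    rw [← toProg_coe hr, ← hR.head k]
    exact congrArg (Prod.mk _) (apply_only k _ S n i o t)
  | load f r ih =>
    have hr : r ∈ stmts M := mem_stmts_of_mem hq (by simp [stmts₁, stmts₁_self])
    obtain ⟨S', c, h1, h2, h3⟩ := ih hr (f v) hR hH hS
    refine ⟨S', c, h1, h2, .trans (chain_single rfl hS hn hi ho ht ?_) h3⟩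
    rw [← toProg_coe hr]
    rfl
  | branch f r₁ r₂ ih₁ ih₂ =>
    have hr₁ : r₁ ∈ stmts M := mem_stmts_of_mem hq (by simp [stmts₁, stmts₁_self])
    have hr₂ : r₂ ∈ stmts M := mem_stmts_of_mem hq (by simp [stmts₁, stmts₁_self])
    have key : (explorer M).succ false (.sim ⟨_, hq⟩ v s, contents M S n i o t) =
      (.sim (toProg M (bif f v then r₁ else r₂)) v s, contents M S n i o t) := rfl
    simp only [pushes] at hH
    rw [stepAux]
    cases hf : f v with
    | true =>
      obtain ⟨S', c, h1, h2, h3⟩ := ih₁ hr₁ v hR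
        (fun k => (Nat.add_le_add_left (le_max_left _ _) _).trans (hH k)) hS
      refine ⟨S', c, h1, h2, .trans (chain_single rfl hS hn hi ho ht ?_) h3⟩
      rw [key, hf, ← toProg_coe hr₁]
      rfl
    | false =>
      obtain ⟨S', c, h1, h2, h3⟩ := ih₂ hr₂ v hR
        (fun k => (Nat.add_le_add_left (le_max_right _ _) _).trans (hH k)) hS
      refine ⟨S', c, h1, h2, .trans (chain_single rfl hS hn hi ho ht ?_) h3⟩
      rw [key, hf, ← toProg_coe hr₂]
      rfl
  | goto f =>
    exact ⟨S, _, hR, rfl, chain_single rfl hS hn hi ho ht rfl⟩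
  -- The halting statement is not yet executed: the explorer waits at it, as `Matches` demands.
  | halt => exact ⟨S, _, hR, ⟨_, rfl, rfl⟩, .refl⟩

theorem chain_reaches (hn : n.length ≤ H) (hi : i.length ≤ H) (ho : o.length ≤ H)
    (ht : t.length ≤ H) (s : Bool) {P h : ℕ} (hP : ∀ l, pushes (M.tm.m l) ≤ P)
    {c₀ c : TM2.Cfg M.tm.Γ M.tm.Λ M.tm.σ} (hH : h + P ≤ H)
    (hspace : ∀ c, TM2.Reaches M.tm.m c₀ c → ∀ k, (c.stk k).length ≤ h)
    (hR : Represents c₀.stk S) {d₀ : Ctl (Prog M) M.tm.σ} (hd : Matches s c₀.l c₀.var d₀)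
    (hc : TM2.Reaches M.tm.m c₀ c) :
    ∃ S' d, Represents c.stk S' ∧ Matches s c.l c.var d ∧
      (explorer M).Chain H (d₀, contents M S n i o t) (d, contents M S' n i o t) := by
  induction hc with
  | refl => exact ⟨S, d₀, hR, hd, .refl⟩
  | @tail a b hab hb ih =>
    obtain ⟨S', d, h1, h2, h3⟩ := ih
    have hh := hspace a hab
    obtain ⟨_ | l, v, R⟩ := a
    · cases hb
    · cases hb
      have e : d = .sim ⟨_, mem_stmts M l⟩ v s := by rw [← toProg_coe]; exact h2
      obtain ⟨S'', d', h1', h2', h3'⟩ := chain_stmt hn hi ho ht s (mem_stmts M l) v h1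
        fun k => (Nat.add_le_add (hh k) (hP l)).trans hH
      rw [← e] at h3'
      exact ⟨S'', d', h1', h2', h3.trans h3'⟩

theorem reaches_of_evalsTo {X : Type} {f : X → Option X} {a b : X}
    (h : StateTransition.EvalsTo f a (some b)) : StateTransition.Reaches f a b := by
  obtain ⟨k, hk⟩ := h
  have hnone : ∀ k, (flip bind f)^[k] none = none := by
    intro k
    induction k with
    | zero => rfl
    | succ k ih => rw [Function.iterate_succ_apply]; exact ih
  induction k generalizing a with
  | zero =>
    cases hk
    exact .refl
  | succ k ih =>
    rw [Function.iterate_succ_apply] at hk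
    have e : flip bind f (some a) = f a := rfl
    rw [e] at hk
    cases hf : f a with
    | none =>
      rw [hf, hnone] at hk
      cases hk
    | some a' =>
      rw [hf] at hk
      exact .head hf (ih hk)

theorem initList_stk (w : List (M.tm.Γ M.tm.k₀)) :
    (initList M.tm w).stk = Function.update (fun _ => []) M.tm.k₀ w := by
  funext k
  by_cases hk : k = M.tm.k₀
  · subst hk
    rw [Function.update_self]
    exact dif_pos rfl
  · rw [Function.update_of_ne hk]
    exact dif_neg hk

theorem haltList_stk (w : List (M.tm.Γ M.tm.k₁)) : (haltList M.tm w).stk M.tm.k₁ = w :=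
  dif_pos rfl

/-- The stacks of the uniformity machine at the beginning. -/
def startStacks (w : List (Option Bool)) : M.tm.K → List (Sym M) :=
  Function.update (fun _ => []) M.tm.k₀ ((w.map (letter M)).map (toInput M))

theorem represents_startStacks (w : List (Option Bool)) :
    Represents (initList M.tm (w.map M.inputAlphabet.symm)).stk (startStacks w) := by
  rw [initList_stk]
  refine Represents.update (fun k => rfl) ?_
  rw [List.map_map, List.map_map, List.map_map]
  exact List.map_congr_left fun b _ => dif_pos rfl

/-- This is the only kind of state in which the two successors differ; from here on the control
state remembers `s`. -/
theorem succ_node (s : Bool) (κ : Kind) (w : List (Option Bool)) :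
    (explorer M).succ s (.node κ, contents M (fun _ => []) n w [] []) =
      (.sim (toProg M (M.tm.m M.tm.main)) M.tm.initialState s,
        contents M (startStacks w) n [] [] []) := by
  refine congrArg (Prod.mk _) (funext fun j => ?_)
  rcases j with k | _ | _ | _ | _
  · by_cases hk : k = M.tm.k₀
    · subst hk
      simp only [explorer, act, startOps, contents, startStacks, Function.update_self, if_pos]
      rfl
    · simp only [explorer, act, startOps, contents, startStacks, Function.update_of_ne hk,
        if_neg hk]
      rfl
  all_goals rfl

/-- After the simulated run, one further step, at the halting statement, translates the output and
empties the simulated stacks for the next query. The answer fits because it lies on a stack within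
the space bound. -/
theorem chain_query (hn : n.length ≤ H) (s : Bool) {P h : ℕ} (hP : ∀ l, pushes (M.tm.m l) ≤ P)
    (hH : h + P ≤ H) {w w' : List (Option Bool)}
    (hout : Nonempty (TM2Outputs M.tm (w.map M.inputAlphabet.symm)
      (some (w'.map M.outputAlphabet.symm))))
    (hspace : UsesSpace M.tm (w.map M.inputAlphabet.symm) h) :
    w'.length ≤ H ∧ (explorer M).Chain H
      (.sim (toProg M (M.tm.m M.tm.main)) M.tm.initialState s,
        contents M (startStacks w) n [] [] [])
      (if s then .skip true else .ty0, contents M (fun _ => []) n [] w' []) := by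
  obtain ⟨hout⟩ := hout
  have hr : TM2.Reaches M.tm.m (initList M.tm (w.map M.inputAlphabet.symm))
      (haltList M.tm (w'.map M.outputAlphabet.symm)) := reaches_of_evalsTo hout
  have z : ([] : List (Option Bool)).length ≤ H := Nat.zero_le _
  obtain ⟨S', d, h1, ⟨q, hq, rfl⟩, h3⟩ := chain_reaches hn z z z s hP hH hspace
    (represents_startStacks w) (d₀ := .sim (toProg M (M.tm.m M.tm.main)) M.tm.initialState s)
    rfl hr
  have hlen := fun k => (hspace _ hr k).trans ((Nat.le_add_right _ _).trans hH)
  refine ⟨?_, h3.trans (chain_single rfl (fun k => (h1.length_eq k).trans_le (hlen k)) hn z z z ?_)⟩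
  · have := hlen M.tm.k₁
    rw [haltList_stk, List.length_map] at this
    exact this
  · obtain ⟨q, hq'⟩ := q
    cases hq
    have ho : (S' M.tm.k₁).map (toOutput M) = w'.map (letter M) := by
      have h := h1 M.tm.k₁
      rw [haltList_stk, List.map_map] at h
      have e : toOutput M = (fun a => letter M (a.bind M.outputAlphabet)) ∘ value M M.tm.k₁ := rfl
      rw [e, ← List.map_map, h, List.map_map]
      exact List.map_congr_left fun b _ => congrArg (letter M) (M.outputAlphabet.apply_symm_apply b)
    refine congrArg (Prod.mk _) (funext fun j => ?_)
    rcases j with k | _ | _ | _ | _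
    · rfl
    · rfl
    · rfl
    · exact ho
    · rfl

/-! ### Configurations that represent gates -/

/-- The configuration that represents a gate. -/
noncomputable def gateCfg {m : ℕ} (C : Circuit m) (g : List Bool) : (explorer M).Cfg :=
  (.node (C.gate g).kind, contents M (fun _ => []) (none :: m.bits.map some)
    (gateWord (C.gate g) g (none :: m.bits.map some)) [] [])

theorem childrenWord_eq {m : ℕ} (C : Circuit m) (g : List Bool) :
    childrenWord C g = (C.gate g).children.flatMap fun c => entry (C.gate c) c := rfl

theorem length_queryWord (g : List Bool) (m : ℕ) :
    (queryWord g m).length = g.length + (m.size + 1) := by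
  simp [queryWord, Nat.size_eq_bits_len]

/-- The child that is explored for the Boolean value `s`. -/
def childAt (G : Gate) (s : Bool) : List Bool := G.children.getD s.toNat []

theorem childAt_mem {G : Gate} {s : Bool} (hs : s ∈ StackMachine.sides G.kind) :
    childAt G s ∈ G.children := by
  cases G <;> cases s <;>
    simp_all [Gate.kind, StackMachine.sides, childAt, Gate.children]

theorem childrenWord_split {m : ℕ} (C : Circuit m) (g : List Bool) {s : Bool}
    (hs : s ∈ StackMachine.sides (C.gate g).kind) :
    ∃ r, childrenWord C g =
      (if s then entry (C.gate (childAt (C.gate g) false)) (childAt (C.gate g) false) else []) ++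
        (entry (C.gate (childAt (C.gate g) s)) (childAt (C.gate g) s) ++ r) := by
  rw [childrenWord_eq]
  generalize C.gate g = G at hs ⊢
  cases G <;> cases s <;>
    simp_all [Gate.kind, StackMachine.sides, childAt, Gate.children]

/-- A query about `g` reveals the types of its children but not its own. Since the type of each
child goes into the control state along with its label onto the input stack, one query per step down
the circuit suffices. -/
theorem chain_child {m P h : ℕ} (C : Circuit m) (hP : ∀ l, pushes (M.tm.m l) ≤ P)
    (hH : h + P ≤ H)
    (hC : ∀ g ∈ C.gates, Nonempty (TM2Outputs M.tm ((queryWord g m).map M.inputAlphabet.symm)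
        (some ((childrenWord C g).map M.outputAlphabet.symm))) ∧
      UsesSpace M.tm ((queryWord g m).map M.inputAlphabet.symm) h ∧ (queryWord g m).length ≤ H)
    {g : List Bool} (hg : g ∈ C.gates) {s : Bool}
    (hs : s ∈ StackMachine.sides (C.gate g).kind) :
    (explorer M).Chain H ((explorer M).succ s (gateCfg C g))
      (gateCfg C (childAt (C.gate g) s)) := by
  obtain ⟨hout, hspace, hlen⟩ := hC g hg
  have hn : (none :: m.bits.map some).length ≤ H := by
    rw [length_queryWord] at hlen
    rw [List.length_cons, List.length_map, Nat.size_eq_bits_len]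
    omega
  have z : ([] : List (Option Bool)).length ≤ H := Nat.zero_le _
  have zS : ∀ k : M.tm.K, ((fun _ => [] : M.tm.K → List (Sym M)) k).length ≤ H :=
    fun _ => Nat.zero_le _
  -- A gate with a child is not an input gate, so the input stack holds a query and not an index.
  have hw : gateWord (C.gate g) g (none :: m.bits.map some) = queryWord g m := by
    cases hG : C.gate g <;> first | rfl | (rw [hG] at hs; cases hs)
  rw [gateCfg, succ_node, hw]
  obtain ⟨hl, h1⟩ := chain_query hn s hP hH hout hspace
  refine h1.trans ?_
  obtain ⟨r, hr⟩ := childrenWord_split C g hs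
  have hc := (hC _ (C.child_mem g hg _ (childAt_mem hs))).2.2
  rw [hr] at hl ⊢
  have h2 : ∀ o, (entry (C.gate (childAt (C.gate g) s)) (childAt (C.gate g) s) ++ o).length ≤ H →
    (explorer M).Chain H (.ty0, contents M (fun _ => []) (none :: m.bits.map some) []
      (entry (C.gate (childAt (C.gate g) s)) (childAt (C.gate g) s) ++ o) [])
      (gateCfg C (childAt (C.gate g) s)) := fun o ho => chain_entry zS _ _ ho hc
  cases s with
  | false => exact h2 r hl
  | true =>
    simp only [if_true] at hl ⊢
    have h3 := h2 r (by rw [List.length_append] at hl; omega)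
    generalize entry (C.gate (childAt (C.gate g) true)) (childAt (C.gate g) true) ++ r = o at *
    refine .trans ?_ h3
    rw [entry, List.append_assoc, List.cons_append, List.append_assoc] at hl ⊢
    refine (chain_skip zS hn z z _ hl true).trans (chain_skip zS hn z z _ ?_ false)
    rw [List.length_append, List.length_cons] at hl
    exact Nat.le_of_succ_le ((Nat.le_add_left _ _).trans hl)

/-- Induction along the wires of `C`: the gate at a node has the kind of the gate it represents, and
each successor evaluates like the child to which `chain_child` leads. -/
theorem evaluates_gateCfg {m P h : ℕ} (C : Circuit m) (hP : ∀ l, pushes (M.tm.m l) ≤ P)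
    (hH : h + P ≤ H)
    (hC : ∀ g ∈ C.gates, Nonempty (TM2Outputs M.tm ((queryWord g m).map M.inputAlphabet.symm)
        (some ((childrenWord C g).map M.outputAlphabet.symm))) ∧
      UsesSpace M.tm ((queryWord g m).map M.inputAlphabet.symm) h ∧ (queryWord g m).length ≤ H)
    {x : List Bool} (hx : x.length = m) {g : List Bool} (hg : g ∈ C.gates) :
    (explorer M).Evaluates H m.size x (gateCfg C g) (C.val x g) := by
  induction g using C.acyclic.induction with
  | _ g ih =>
    have hlen := (hC g hg).2.2
    rw [length_queryWord] at hlen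
    have hbits : ∀ i, i < m → i.bits.length ≤ m.size := fun i hi => by
      rw [Nat.size_eq_bits_len]
      exact Nat.size_le_size hi.le
    have hin : (gateWord (C.gate g) g (none :: m.bits.map some)).length ≤ H := by
      cases hG : C.gate g with
      | input i =>
        have := hbits i (C.input_lt g hg i hG)
        rw [gateWord, List.length_map]
        omega
      | _ => exact (hC g hg).2.2
    have h := StackMachine.Evaluates.intro (M := explorer M) (S := H) (L := m.size) (x := x)
      (gateCfg C g) (fun s => C.val x (childAt (C.gate g) s)) ?_ ?_ ?_
    · rw [C.val_eq x hg]
      have e : ∀ b, StackMachine.evalKind x ((explorer M).index (gateCfg C g))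
          (fun s => C.val x (childAt (C.gate g) s)) ((explorer M).kind (gateCfg C g).1) = b ↔
            (C.gate g).eval x (C.val x) = b := by
        intro b
        have hk : (explorer M).kind (gateCfg C g).1 = (C.gate g).kind := rfl
        rw [hk]
        have hi : ∀ i, C.gate g = .input i → (explorer M).index (gateCfg C g) = i := by
          intro i hG
          have : ((gateCfg (M := M) C g).2 (.inr .inp)).map (explorer M).idxBit = i.bits := by
            simp [gateCfg, contents, hG, gateWord, explorer, letter, toLetter,
              Function.comp_def]
          exact (congrArg bitsVal this).trans (bitsVal_bits i)
        cases hG : C.gate g with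
        | input i => rw [hi i hG]; rfl
        | _ => rfl
      rwa [(e _).1 rfl]
    · intro j
      rcases j with k | _ | _ | _ | _
      · exact Nat.zero_le _
      · simp only [gateCfg, contents, List.length_map, List.length_cons, Nat.size_eq_bits_len]
        omega
      · simpa [gateCfg, contents] using hin
      · exact Nat.zero_le _
      · exact Nat.zero_le _
    · intro hk
      cases hG : C.gate g with
      | input i =>
        have hi := C.input_lt g hg i hG
        have hw : ((gateCfg (M := M) C g).2 (.inr .inp)) = (i.bits.map some).map (letter M) := by
          simp [gateCfg, contents, hG, gateWord]
        have : ((gateCfg (M := M) C g).2 (.inr .inp)).map (explorer M).idxBit = i.bits := by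
          rw [hw]
          simp [explorer, letter, toLetter, Function.comp_def]
        refine ⟨?_, ?_⟩
        · have := congrArg List.length hw
          rw [List.length_map, List.length_map] at this
          exact this.trans_le (hbits i hi)
        · rw [hx]
          exact ((congrArg bitsVal this).trans (bitsVal_bits i)).trans_lt hi
      | _ =>
        have hk' : (C.gate g).kind = .input := hk
        rw [hG] at hk'
        cases hk'
    · intro s hs
      have hmem := childAt_mem (G := C.gate g) hs
      exact (chain_child C hP hH hC hg hs).evaluates
        (ih _ ⟨hg, hmem⟩ (C.child_mem g hg _ hmem))

end Explorer

theorem theorem3 (f : List Bool → Bool)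
    (hf : ∃ C' : (n : ℕ) → Circuit n, PolySize C' ∧ LogSpaceUniform C' ∧ Computes C' f) :
    ∃ C : (n : ℕ) → Circuit n, PolySize C ∧ Computes C f ∧
      ∃ D : ℕ → LocalMap,
        -- a machine prints `D n` in time polynomial in the length of `n` in binary
        Nonempty (Turing.TM2ComputableInPolyTime Nat.bits LocalMap.word D) ∧
        ∃ c k : ℕ, ∀ n,
          -- `D n` maps labels, of length `O(log n)`, to a type, an index and two labels
          (D n).inLen = (C n).len ∧ (C n).len ≤ c * (Nat.log 2 n + 1) ∧
          (D n).out.length = 3 + Nat.size n + 2 * (C n).len ∧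
          -- constant locality
          (D n).HasLocality k ∧
          -- on the label of a gate, `D n` outputs its type and the labels of its children
          (∀ g ∈ (C n).gates, (D n).gateAt n g = (C n).gate g) ∧
          -- the wires that `D n` describes on all strings, gate labels or not, form no cycle
          ∀ g : List Bool, ¬ Relation.TransGen
            (fun a b => a.length = (C n).len ∧ b ∈ ((D n).gateAt n a).children) g g := by
  obtain ⟨C', -, ⟨M, c, hM⟩, hcomp⟩ := hf
  obtain ⟨P, hP⟩ := Explorer.exists_pushes_le M
  have := M.tm.kFin
  have := M.tm.σFin
  have := M.tm.Γk₀Fin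
  have := (Explorer.finite_stmts M).to_subtype
  -- The stacks need the space of the uniformity machine, governed by `c`, and room for `P` pushes
  -- within a step; the summand `1` gives `1 ≤ a`.
  refine (Explorer.explorer M).exists_local_uniform (a := c + P + 1) (by omega)
    -- The type and label of the output gate need not be computed: they enter only the label of the
    -- new output gate, on which the local map does not depend.
    (fun n => Explorer.gateCfg (C' n) (C' n).out) f fun n x hx => ?_
  rw [← hcomp n x hx]
  have hlog : Nat.log 2 n ≤ n.size := by
    rcases n.eq_zero_or_pos with rfl | hn
    · simp
    · exact (Nat.lt_size.2 (Nat.pow_log_le_self 2 hn.ne')).le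
  have hH : c * (Nat.log 2 n + 1) + P ≤ (c + P + 1) * n.size + (c + P + 1) + 2 := by
    have := Nat.mul_le_mul_left c hlog
    rw [Nat.mul_succ, Nat.add_mul, Nat.add_mul]
    omega
  refine Explorer.evaluates_gateCfg (C' n) hP hH (fun g hg => ?_) hx (C' n).out_mem
  obtain ⟨hout, hspace⟩ := hM n g hg
  refine ⟨hout, hspace, ?_⟩
  -- The query lies on the input stack at the start, so the space bound limits its length.
  have := hspace _ .refl M.tm.k₀
  rw [Explorer.initList_stk, Function.update_self, List.length_map] at this
  omega
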